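/- **Notation.** Let $K$ be a field of characteristic zero (for instance $K=\mathbb{Q}$) and $n\ge 0$. Let ${\sf ass}_n$ be the free associative $K$-algebra on $x_1,\dots,x_n$, with coproduct $\Delta(x_i)=x_i\otimes 1+1\otimes x_i$ and antipode $\iota$ (the anti-automorphism with $\iota(x_i)=-x_i$). Let ${\sf lie}_n$ be the free Lie algebra on $x_1,\dots,x_n$, regarded inside ${\sf ass}_n$. Put ${\sf tr}_n={\sf ass}_n/[{\sf ass}_n,{\sf ass}_n]$, where $[{\sf ass}_n,{\sf ass}_n]$ is the span of the commutators, with projection $|\ |:{\sf ass}_n\to{\sf tr}_n$, and $x_0=x_1+\cdots+x_n$. *Tangential derivations.* An element $\tilde u=(u_1,\dots,u_n)$ of ${\sf tder}_n={\sf lie}_n^{\oplus n}$ acts on ${\sf ass}_n$ by the derivation $\rho(\tilde u)$ with $\rho(\tilde u)(x_i)=[x_i,u_i]$, hence on ${\sf tr}_n$, and on tensor products by $\rho(\tilde u)\otimes{\rm id}+{\rm id}\otimes\rho(\tilde u)$. Let ${\sf sder}_n=\{\tilde u\in{\sf tder}_n : \rho(\tilde u)(x_0)=0\}$. Let $\partial_i$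 be the linear operators with $\partial_i(1)=0$ and $\partial_i(a x_j)=\delta_{ij}a$ for $a\in{\sf ass}_n$, and put ${\rm div}(\tilde u)=\sum_{i=1}^n|x_i(\partial_iu_i)|\in{\sf tr}_n$. Then - ${\sf krv}_n$ is the set of $\tilde u\in{\sf sder}_n$ such that ${\rm div}(\tilde u)=\sum_{i=0}^n|f_i(x_i)|$, in the degree completion of ${\sf tr}_n$, for some formal power series $f_0,\dots,f_n\in K[[s]]$; - ${\sf krv}_n^0$ is the set of $\tilde u\in{\sf sder}_n$ such that ${\rm div}(\tilde u)$ lies in the span of $|x_1|,\dots,|x_n|$. *Operations.* Let $\mathfrak z(x_i,x_j)=\delta_{ij}x_i$. The linearized homotopy intersection form $\eta_{\rm gr}:{\sf ass}_n\otimes{\sf ass}_n\to{\sf ass}_n$ is the linear map with $\eta_{\rm gr}(1,v)=\eta_{\rm gr}(u,1)=0$ and, for letters $a_i,b_j\in\{x_1,\dots,x_n\}$ and $l,m\ge1$, $$\eta_{\rm gr}(a_1\cdots a_l,\,b_1\cdots b_m)=-a_1\cdots a_{l-1}\,\mathfrak z(a_l,b_1)\,b_2\cdots b_m .$$ The linear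 map $\mu^f_{\rm gr}:{\sf ass}_n\to{\sf ass}_n$ is given by $$\mu^f_{\rm gr}(a_1\cdots a_m)=-\sum_{j=1}^{m-1}a_1\cdots a_{j-1}\,\mathfrak z(a_j,a_{j+1})\,a_{j+2}\cdots a_m .$$ Let $\mu^f_{r,\rm gr}:{\sf ass}_n\to{\sf tr}_n\otimes{\sf ass}_n$ be the composition of $\Delta$, ${\rm id}\otimes\mu^f_{\rm gr}$, ${\rm id}\otimes((\iota\otimes{\rm id})\circ\Delta)$ and $(|\ |\circ{\rm mult})\otimes{\rm id}$. The linearized framed Turaev cobracket $\delta^f_{\rm gr}:{\sf tr}_n\to{\sf tr}_n\otimes{\sf tr}_n$ is the (well-defined) linear map with $$\delta^f_{\rm gr}(|a|)={\rm Alt}\circ({\rm id}\otimes|\ |)\circ\mu^f_{r,\rm gr}(a),\qquad {\rm Alt}(p\otimes q)=p\otimes q-q\otimes p .$$ **Theorem.** Let $\tilde u=(u_1,\dots,u_n)\in{\sf tder}_n$. (i) $\tilde u\in{\sf krv}_n$ if and only if $\rho(\tilde u)$ commutes with $\eta_{\rm gr}$ and with $\delta^f_{\rm gr}$, that is, $\rho(\tilde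 u)\circ\eta_{\rm gr}=\eta_{\rm gr}\circ(\rho(\tilde u)\otimes{\rm id}+{\rm id}\otimes\rho(\tilde u))$ and $(\rho(\tilde u)\otimes{\rm id}+{\rm id}\otimes\rho(\tilde u))\circ\delta^f_{\rm gr}=\delta^f_{\rm gr}\circ\rho(\tilde u)$. (ii) $\tilde u\in{\sf krv}_n^0$ if and only if $\rho(\tilde u)$ commutes with $\eta_{\rm gr}$ and with $\mu^f_{\rm gr}$, the latter meaning $\rho(\tilde u)\circ\mu^f_{\rm gr}=\mu^f_{\rm gr}\circ\rho(\tilde u)$. -/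

import Mathlib

open scoped TensorProduct

noncomputable section

namespace KV

variable (K : Type*) [Field K] (n : ℕ)

attribute [local instance 100] LieRing.ofAssociativeRing

/-! ### The free associative algebra `ass_n` and its trace space `tr_n` -/

/-- `ass_n`: the free associative algebra on `x_1, …, x_n`. -/
abbrev Ass : Type _ := FreeAlgebra K (Fin n)

/-- The generators `x_1, …, x_n` (indexed from `0`). -/
abbrev gen (i : Fin n) : Ass K n := FreeAlgebra.ι K i

/-- The element `x_0 = x_1 + ⋯ + x_n`. -/
def gen₀ : Ass K n := ∑ i, gen K n i

/-- The word `x_{i_1} ⋯ x_{i_m}` of `ass_n`. -/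
def word (l : List (Fin n)) : Ass K n := (l.map (gen K n)).prod

/-- The words form a basis of `ass_n`. -/
abbrev wordBasis : Module.Basis (FreeMonoid (Fin n)) K (Ass K n) :=
  FreeAlgebra.basisFreeMonoid K (Fin n)

/-- The linear map out of `ass_n` with prescribed values on words. -/
def onWords {M : Type*} [AddCommGroup M] [Module K M] (f : List (Fin n) → M) :
    Ass K n →ₗ[K] M :=
  (wordBasis K n).constr K fun w => f (FreeMonoid.toList w)

/-- The subspace `[ass_n, ass_n]` spanned by the commutators. -/
def commutators : Submodule K (Ass K n) :=
  Submodule.span K {c | ∃ a b : Ass K n, c = a * b - b * a}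

/-- `tr_n = |ass_n| = ass_n / [ass_n, ass_n]`. -/
abbrev Tr : Type _ := Ass K n ⧸ commutators K n

/-- The projection `| | : ass_n → tr_n`. -/
def tr : Ass K n →ₗ[K] Tr K n := (commutators K n).mkQ

/-! ### Hopf algebra structure of `ass_n` -/

/-- The coproduct: the algebra map with `Δ(x_i) = x_i ⊗ 1 + 1 ⊗ x_i`. -/
def coproduct : Ass K n →ₐ[K] Ass K n ⊗[K] Ass K n :=
  FreeAlgebra.lift K fun i => gen K n i ⊗ₜ[K] 1 + 1 ⊗ₜ[K] gen K n i

/-- The antipode: the linear anti-automorphism with `ι(x_i) = - x_i`. -/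
def antipode : Ass K n →ₗ[K] Ass K n :=
  (MulOpposite.opLinearEquiv K).symm.toLinearMap ∘ₗ
    (FreeAlgebra.lift K fun i => MulOpposite.op (-gen K n i) :
      Ass K n →ₐ[K] (Ass K n)ᵐᵒᵖ).toLinearMap

/-! ### The linearized loop operations -/

/-- The bilinear map `𝔷` on letters: `𝔷(x_i, x_j) = δ_{ij} x_i`. -/
def zz (i j : Fin n) : Ass K n := if i = j then gen K n i else 0

/-- Given `a_1 ⋯ a_l` (as `u`) and `b_1 ⋯ b_m` (as `v`), the element
`- a_1 ⋯ a_{l-1} 𝔷(a_l, b_1) b_2 ⋯ b_m`; it is `0` if one of the words is empty. -/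
def etaWord (u v : List (Fin n)) : Ass K n :=
  match u.getLast?, v with
  | some i, j :: v' => -(word K n u.dropLast * zz K n i j * word K n v')
  | _, _ => 0

/-- The linearized homotopy intersection form, as a bilinear map. -/
def etaBil : Ass K n →ₗ[K] Ass K n →ₗ[K] Ass K n :=
  onWords K n fun u => onWords K n fun v => etaWord K n u v

/-- The linearized homotopy intersection form `η_gr : ass_n ⊗ ass_n → ass_n`. -/
def etaGr : Ass K n ⊗[K] Ass K n →ₗ[K] Ass K n := TensorProduct.lift (etaBil K n)

/-- For the word `a_1 ⋯ a_m`, the element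
`- ∑_{j=1}^{m-1} a_1 ⋯ a_{j-1} 𝔷(a_j, a_{j+1}) a_{j+2} ⋯ a_m`
(the first summand is split off, and `a_1` is factored out of the others). -/
def muWord : List (Fin n) → Ass K n
  | [] => 0
  | [_] => 0
  | i :: j :: l => -(zz K n i j * word K n l) + gen K n i * muWord (j :: l)

/-- The map `μ^f_gr : ass_n → ass_n`. -/
def muGr : Ass K n →ₗ[K] Ass K n := onWords K n (muWord K n)

/-- The map `a ⊗ b ↦ ∑ |a ι(b')| ⊗ b''`, where `Δ(b) = ∑ b' ⊗ b''`: the composition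
`((| | ∘ mult) ⊗ id) ∘ (id ⊗ ((ι ⊗ id) ∘ Δ))`. -/
def closeUp : Ass K n ⊗[K] Ass K n →ₗ[K] Tr K n ⊗[K] Ass K n :=
  LinearMap.rTensor (Ass K n) (tr K n ∘ₗ LinearMap.mul' K (Ass K n)) ∘ₗ
    (TensorProduct.assoc K (Ass K n) (Ass K n) (Ass K n)).symm.toLinearMap ∘ₗ
      LinearMap.lTensor (Ass K n)
        (LinearMap.rTensor (Ass K n) (antipode K n) ∘ₗ (coproduct K n).toLinearMap)

/-- The map `μ^f_{r,gr} : ass_n → tr_n ⊗ ass_n`, namely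
`((| | ∘ mult) ⊗ id) ∘ (id ⊗ ((ι ⊗ id) ∘ Δ)) ∘ (id ⊗ μ^f_gr) ∘ Δ`. -/
def murGr : Ass K n →ₗ[K] Tr K n ⊗[K] Ass K n :=
  closeUp K n ∘ₗ LinearMap.lTensor (Ass K n) (muGr K n) ∘ₗ (coproduct K n).toLinearMap

/-- `Alt(a ⊗ b) = a ⊗ b - b ⊗ a`. -/
def alt (V : Type*) [AddCommGroup V] [Module K V] : V ⊗[K] V →ₗ[K] V ⊗[K] V :=
  LinearMap.id - (TensorProduct.comm K V V).toLinearMap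

/-- The map `Alt ∘ (id ⊗ | |) ∘ μ^f_{r,gr} : ass_n → tr_n ⊗ tr_n`. -/
def deltaLift : Ass K n →ₗ[K] Tr K n ⊗[K] Tr K n :=
  alt K (Tr K n) ∘ₗ LinearMap.lTensor (Tr K n) (tr K n) ∘ₗ murGr K n

/-! #### `deltaLift` vanishes on commutators, hence descends to `tr_n` -/

section descent

theorem word_nil : word K n [] = 1 := rfl

theorem word_cons (i : Fin n) (l : List (Fin n)) :
    word K n (i :: l) = gen K n i * word K n l := by simp [word]

theorem word_append (l m : List (Fin n)) : word K n (l ++ m) = word K n l * word K n m := by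
  simp [word]

theorem word_single (i : Fin n) : word K n [i] = gen K n i := by simp [word]

theorem wordBasis_apply (w : FreeMonoid (Fin n)) :
    wordBasis K n w = word K n (FreeMonoid.toList w) := by
  simp [wordBasis, FreeAlgebra.basisFreeMonoid, FreeAlgebra.equivMonoidAlgebraFreeMonoid, word,
    FreeMonoid.lift_apply]

theorem onWords_word {M : Type*} [AddCommGroup M] [Module K M] (f : List (Fin n) → M)
    (l : List (Fin n)) : onWords K n f (word K n l) = f l := by
  have h := wordBasis_apply K n (FreeMonoid.ofList l)
  rw [FreeMonoid.toList_ofList] at h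
  rw [← h, onWords, Module.Basis.constr_basis, FreeMonoid.toList_ofList]

/-- Linear maps out of `ass_n` that agree on words are equal. -/
theorem ext_words {M : Type*} [AddCommGroup M] [Module K M] {f g : Ass K n →ₗ[K] M}
    (h : ∀ l, f (word K n l) = g (word K n l)) : f = g :=
  (wordBasis K n).ext fun w => by rw [wordBasis_apply]; exact h _

theorem tr_mul_comm (a b : Ass K n) : tr K n (a * b) = tr K n (b * a) := by
  rw [← sub_eq_zero, ← map_sub]
  exact (Submodule.Quotient.mk_eq_zero _).2 (Submodule.subset_span ⟨a, b, rfl⟩)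

theorem coproduct_gen (i : Fin n) :
    coproduct K n (gen K n i) = gen K n i ⊗ₜ[K] 1 + 1 ⊗ₜ[K] gen K n i := by
  simp [coproduct]

theorem antipode_gen (i : Fin n) : antipode K n (gen K n i) = -gen K n i := by
  simp [antipode]

theorem antipode_one : antipode K n 1 = 1 := by simp [antipode]

theorem antipode_mul (a b : Ass K n) :
    antipode K n (a * b) = antipode K n b * antipode K n a := by
  simp [antipode]

theorem etaBil_gen_word (i : Fin n) (l : List (Fin n)) :
    etaBil K n (gen K n i) (word K n l) = etaWord K n [i] l := by
  rw [← word_single, etaBil, onWords_word, onWords_word]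

theorem etaBil_gen_mul (i j : Fin n) (a : Ass K n) :
    etaBil K n (gen K n i) (gen K n j * a) = if j = i then -(gen K n i * a) else 0 := by
  have : etaBil K n (gen K n i) ∘ₗ LinearMap.mulLeft K (gen K n j) =
      if j = i then -LinearMap.mulLeft K (gen K n i) else 0 := by
    refine ext_words K n fun l => ?_
    rw [LinearMap.comp_apply, LinearMap.mulLeft_apply, ← word_cons, etaBil_gen_word]
    by_cases h : j = i
    · simp [etaWord, zz, h, word_nil]
    · simp [etaWord, zz, h, Ne.symm h]
  have h := LinearMap.congr_fun this a
  rw [LinearMap.comp_apply, LinearMap.mulLeft_apply] at h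
  rw [h]
  split_ifs <;> simp

theorem etaBil_mul_gen (i j : Fin n) (a : Ass K n) :
    etaBil K n (a * gen K n j) (gen K n i) = if j = i then -(a * gen K n i) else 0 := by
  have : (etaBil K n).flip (gen K n i) ∘ₗ LinearMap.mulRight K (gen K n j) =
      if j = i then -LinearMap.mulRight K (gen K n i) else 0 := by
    refine ext_words K n fun l => ?_
    rw [LinearMap.comp_apply, LinearMap.mulRight_apply, ← word_single K n j, ← word_append,
      LinearMap.flip_apply]
    conv_lhs => rw [← word_single K n i, etaBil, onWords_word, onWords_word]
    by_cases h : j = i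
    · simp [etaWord, zz, h, word_nil]
    · simp [etaWord, zz, h]
  have h := LinearMap.congr_fun this a
  rw [LinearMap.comp_apply, LinearMap.mulRight_apply] at h
  rw [← LinearMap.flip_apply, h]
  split_ifs <;> simp

theorem muGr_gen_mul (i : Fin n) (a : Ass K n) :
    muGr K n (gen K n i * a) = gen K n i * muGr K n a + etaBil K n (gen K n i) a := by
  have : muGr K n ∘ₗ LinearMap.mulLeft K (gen K n i) =
      LinearMap.mulLeft K (gen K n i) ∘ₗ muGr K n + etaBil K n (gen K n i) := by
    refine ext_words K n fun l => ?_
    simp only [LinearMap.comp_apply, LinearMap.mulLeft_apply, LinearMap.add_apply]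
    rw [← word_cons, etaBil_gen_word, muGr, onWords_word, onWords_word]
    cases l with
    | nil => simp [muWord, etaWord]
    | cons j l => simp [muWord, etaWord, word_nil, add_comm]
  exact LinearMap.congr_fun this a

theorem muWord_append_single (i : Fin n) (l : List (Fin n)) :
    muWord K n (l ++ [i]) = muWord K n l * gen K n i + etaWord K n l [i] := by
  induction l with
  | nil => simp [muWord, etaWord]
  | cons j l ih =>
    cases l with
    | nil => simp [muWord, etaWord, word_nil]
    | cons k l =>
      have e : etaWord K n (j :: k :: l) [i] = gen K n j * etaWord K n (k :: l) [i] := by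
        simp only [etaWord, List.getLast?_cons_cons]
        have : (k :: l).getLast? = some ((k :: l).getLast (by simp)) :=
          List.getLast?_eq_some_getLast (by simp)
        rw [this]
        simp [word_cons, mul_assoc]
      simp only [List.cons_append, muWord] at ih ⊢
      rw [ih, e, word_append, word_single]
      noncomm_ring

theorem muGr_mul_gen (i : Fin n) (a : Ass K n) :
    muGr K n (a * gen K n i) = muGr K n a * gen K n i + etaBil K n a (gen K n i) := by
  have : muGr K n ∘ₗ LinearMap.mulRight K (gen K n i) =
      LinearMap.mulRight K (gen K n i) ∘ₗ muGr K n + (etaBil K n).flip (gen K n i) := by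
    refine ext_words K n fun l => ?_
    simp only [LinearMap.comp_apply, LinearMap.mulRight_apply, LinearMap.add_apply,
      LinearMap.flip_apply]
    rw [← word_single, ← word_append, muGr, etaBil]
    simp only [onWords_word]
    rw [muWord_append_single, word_single]
  exact LinearMap.congr_fun this a

/-- Left multiplication by `x_i` on the second factor of `tr_n ⊗ ass_n`. -/
def lmul (i : Fin n) : Tr K n ⊗[K] Ass K n →ₗ[K] Tr K n ⊗[K] Ass K n :=
  LinearMap.lTensor (Tr K n) (LinearMap.mulLeft K (gen K n i))

/-- Right multiplication by `x_i` on the second factor of `tr_n ⊗ ass_n`. -/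
def rmul (i : Fin n) : Tr K n ⊗[K] Ass K n →ₗ[K] Tr K n ⊗[K] Ass K n :=
  LinearMap.lTensor (Tr K n) (LinearMap.mulRight K (gen K n i))

/-- The map `p ⊗ q ↦ |a ι(p)| ⊗ q`. -/
def closeAux (a : Ass K n) : Ass K n ⊗[K] Ass K n →ₗ[K] Tr K n ⊗[K] Ass K n :=
  LinearMap.rTensor (Ass K n) (tr K n ∘ₗ LinearMap.mulLeft K a ∘ₗ antipode K n)

theorem closeUp_tmul (a b : Ass K n) :
    closeUp K n (a ⊗ₜ b) = closeAux K n a (coproduct K n b) := by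
  simp only [closeUp, closeAux, LinearMap.comp_apply, LinearMap.lTensor_tmul,
    AlgHom.toLinearMap_apply]
  induction coproduct K n b with
  | zero => simp
  | tmul p q => simp
  | add s t hs ht => rw [map_add, TensorProduct.tmul_add, map_add, map_add, map_add, hs, ht]

theorem closeUp_left (i : Fin n) (t : Ass K n ⊗[K] Ass K n) :
    closeUp K n ((1 ⊗ₜ gen K n i) * t) =
      -closeUp K n ((gen K n i ⊗ₜ 1) * t) + lmul K n i (closeUp K n t) := by
  induction t with
  | zero => simp
  | add s t hs ht => simp only [mul_add, map_add, hs, ht]; abel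
  | tmul a b =>
    simp only [Algebra.TensorProduct.tmul_mul_tmul, one_mul, closeUp_tmul, map_mul,
      coproduct_gen]
    induction coproduct K n b with
    | zero => simp
    | add s t hs ht => simp only [mul_add, map_add, hs, ht]; abel
    | tmul p q =>
      have e : tr K n (a * (antipode K n p * gen K n i)) =
          tr K n (gen K n i * (a * antipode K n p)) := by rw [← mul_assoc, tr_mul_comm]
      simp [closeAux, lmul, add_mul, antipode_mul, antipode_gen, TensorProduct.neg_tmul, e]

theorem closeUp_right (i : Fin n) (t : Ass K n ⊗[K] Ass K n) :
    closeUp K n (t * (1 ⊗ₜ gen K n i)) =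
      -closeUp K n (t * (gen K n i ⊗ₜ 1)) + rmul K n i (closeUp K n t) := by
  induction t with
  | zero => simp
  | add s t hs ht => simp only [add_mul, map_add, hs, ht]; abel
  | tmul a b =>
    simp only [Algebra.TensorProduct.tmul_mul_tmul, mul_one, closeUp_tmul, map_mul,
      coproduct_gen]
    induction coproduct K n b with
    | zero => simp
    | add s t hs ht => simp only [add_mul, map_add, hs, ht]; abel
    | tmul p q =>
      simp [closeAux, rmul, mul_add, antipode_mul, antipode_gen, TensorProduct.neg_tmul]

theorem closeUp_coproduct_left (l : List (Fin n)) : ∀ a : Ass K n,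
    closeUp K n ((a ⊗ₜ 1) * coproduct K n (word K n l)) = tr K n a ⊗ₜ word K n l := by
  induction l with
  | nil => intro a; simp [word_nil, closeUp_tmul, closeAux, antipode_one,
      Algebra.TensorProduct.one_def]
  | cons j l ih =>
    intro a
    have h1 : (a ⊗ₜ[K] (1 : Ass K n)) * coproduct K n (word K n (j :: l)) =
        ((a * gen K n j) ⊗ₜ[K] 1) * coproduct K n (word K n l) +
        (1 ⊗ₜ[K] gen K n j) * ((a ⊗ₜ[K] 1) * coproduct K n (word K n l)) := by
      rw [word_cons, map_mul, coproduct_gen, ← mul_assoc, ← mul_assoc, mul_add, add_mul]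
      simp
    have h2 : (gen K n j ⊗ₜ[K] (1 : Ass K n)) * ((a ⊗ₜ[K] 1) * coproduct K n (word K n l)) =
        ((gen K n j * a) ⊗ₜ[K] 1) * coproduct K n (word K n l) := by
      rw [← mul_assoc]; simp
    rw [h1, map_add, closeUp_left, h2, ih, ih, ih, tr_mul_comm]
    simp [lmul, word_cons]

theorem closeUp_coproduct_right (l : List (Fin n)) : ∀ a : Ass K n,
    closeUp K n (coproduct K n (word K n l) * (a ⊗ₜ 1)) = tr K n a ⊗ₜ word K n l := by
  induction l using List.reverseRecOn with
  | nil => intro a; simp [word_nil, closeUp_tmul, closeAux, antipode_one,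
      Algebra.TensorProduct.one_def]
  | append_singleton l j ih =>
    intro a
    have h1 : coproduct K n (word K n (l ++ [j])) * (a ⊗ₜ[K] (1 : Ass K n)) =
        coproduct K n (word K n l) * ((gen K n j * a) ⊗ₜ[K] 1) +
        (coproduct K n (word K n l) * (a ⊗ₜ[K] 1)) * (1 ⊗ₜ[K] gen K n j) := by
      rw [word_append, word_single, map_mul, coproduct_gen, mul_assoc, mul_assoc, add_mul, mul_add]
      simp
    have h2 : (coproduct K n (word K n l) * (a ⊗ₜ[K] 1)) * (gen K n j ⊗ₜ[K] (1 : Ass K n)) =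
        coproduct K n (word K n l) * ((a * gen K n j) ⊗ₜ[K] 1) := by
      rw [mul_assoc]; simp
    rw [h1, map_add, closeUp_right, h2, ih, ih, ih, tr_mul_comm]
    simp [rmul, word_append, word_single]

/-- `∑ u ⊗ v` over the ways of writing a word as `u x_i v`. -/
def splitAt (i : Fin n) : List (Fin n) → Ass K n ⊗[K] Ass K n
  | [] => 0
  | j :: l => (if j = i then 1 ⊗ₜ word K n l else 0) + (gen K n j ⊗ₜ 1) * splitAt i l

theorem splitAt_append_single (i j : Fin n) (l : List (Fin n)) :
    splitAt K n i (l ++ [j]) =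
      (if j = i then word K n l ⊗ₜ 1 else 0) + splitAt K n i l * (1 ⊗ₜ gen K n j) := by
  induction l with
  | nil => simp [splitAt, word_nil]
  | cons k l ih =>
    simp only [List.cons_append, splitAt, ih, word_cons, word_append, add_mul, mul_add, mul_assoc]
    split_ifs <;> simp [add_left_comm, word_nil]

/-- The map `p ⊗ q ↦ |p x_i| ⊗ q - |p| ⊗ x_i q`. -/
def cutL (i : Fin n) : Ass K n ⊗[K] Ass K n →ₗ[K] Tr K n ⊗[K] Ass K n :=
  TensorProduct.map (tr K n ∘ₗ LinearMap.mulRight K (gen K n i)) LinearMap.id -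
    TensorProduct.map (tr K n) (LinearMap.mulLeft K (gen K n i))

/-- The map `p ⊗ q ↦ |q x_i| ⊗ p - |q| ⊗ p x_i`. -/
def cutR (i : Fin n) : Ass K n ⊗[K] Ass K n →ₗ[K] Tr K n ⊗[K] Ass K n :=
  (TensorProduct.map (tr K n ∘ₗ LinearMap.mulRight K (gen K n i)) LinearMap.id -
    TensorProduct.map (tr K n) (LinearMap.mulRight K (gen K n i))) ∘ₗ
      (TensorProduct.comm K (Ass K n) (Ass K n)).toLinearMap

theorem tensor_mul_neg (s t : Ass K n ⊗[K] Ass K n) : s * -t = -(s * t) :=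
  map_neg (LinearMap.mulLeft K s) t

theorem tensor_neg_mul (s t : Ass K n ⊗[K] Ass K n) : -s * t = -(s * t) :=
  map_neg (LinearMap.mulRight K t) s

theorem lTensor_left (f : Ass K n →ₗ[K] Ass K n) (a : Ass K n) (t : Ass K n ⊗[K] Ass K n) :
    LinearMap.lTensor (Ass K n) f ((a ⊗ₜ 1) * t) =
      (a ⊗ₜ 1) * LinearMap.lTensor (Ass K n) f t := by
  induction t with
  | zero => simp
  | add s t hs ht => simp only [mul_add, map_add, hs, ht]
  | tmul p q => simp

theorem lTensor_right (f : Ass K n →ₗ[K] Ass K n) (a : Ass K n) (t : Ass K n ⊗[K] Ass K n) :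
    LinearMap.lTensor (Ass K n) f (t * (a ⊗ₜ 1)) =
      LinearMap.lTensor (Ass K n) f t * (a ⊗ₜ 1) := by
  induction t with
  | zero => simp
  | add s t hs ht => simp only [add_mul, map_add, hs, ht]
  | tmul p q => simp

theorem lTensor_eta_left (i j : Fin n) (t : Ass K n ⊗[K] Ass K n) :
    LinearMap.lTensor (Ass K n) (etaBil K n (gen K n i)) ((1 ⊗ₜ gen K n j) * t) =
      if j = i then -((1 ⊗ₜ gen K n i) * t) else 0 := by
  induction t with
  | zero => simp
  | add s t hs ht =>
    simp only [mul_add, map_add, hs, ht]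
    split_ifs
    · abel
    · simp
  | tmul p q =>
    simp only [Algebra.TensorProduct.tmul_mul_tmul, LinearMap.lTensor_tmul, etaBil_gen_mul]
    split_ifs <;> simp [TensorProduct.tmul_neg]

theorem lTensor_eta_right (i j : Fin n) (t : Ass K n ⊗[K] Ass K n) :
    LinearMap.lTensor (Ass K n) ((etaBil K n).flip (gen K n i)) (t * (1 ⊗ₜ gen K n j)) =
      if j = i then -(t * (1 ⊗ₜ gen K n i)) else 0 := by
  induction t with
  | zero => simp
  | add s t hs ht =>
    simp only [add_mul, map_add, hs, ht]
    split_ifs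
    · abel
    · simp
  | tmul p q =>
    simp only [Algebra.TensorProduct.tmul_mul_tmul, LinearMap.lTensor_tmul, LinearMap.flip_apply,
      etaBil_mul_gen]
    split_ifs <;> simp [TensorProduct.tmul_neg]

theorem closeUp_eta_left (i : Fin n) (l : List (Fin n)) : ∀ a : Ass K n,
    closeUp K n ((a ⊗ₜ 1) * LinearMap.lTensor (Ass K n) (etaBil K n (gen K n i))
      (coproduct K n (word K n l))) = cutL K n i ((a ⊗ₜ 1) * splitAt K n i l) := by
  induction l with
  | nil =>
    intro a
    have : etaBil K n (gen K n i) 1 = 0 := by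
      rw [← word_nil, etaBil_gen_word]; simp [etaWord]
    simp [word_nil, splitAt, Algebra.TensorProduct.one_def, this]
  | cons j l ih =>
    intro a
    have h1 : (a ⊗ₜ[K] (1 : Ass K n)) * splitAt K n i (j :: l) =
        (if j = i then a ⊗ₜ[K] word K n l else 0) +
          ((a * gen K n j) ⊗ₜ[K] 1) * splitAt K n i l := by
      rw [splitAt, mul_add, ← mul_assoc]
      split_ifs <;> simp
    have h2 : (a ⊗ₜ[K] (1 : Ass K n)) * LinearMap.lTensor (Ass K n) (etaBil K n (gen K n i))
        (coproduct K n (word K n (j :: l))) =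
        ((a * gen K n j) ⊗ₜ[K] 1) * LinearMap.lTensor (Ass K n) (etaBil K n (gen K n i))
          (coproduct K n (word K n l)) +
        if j = i then -((1 ⊗ₜ[K] gen K n i) * ((a ⊗ₜ[K] 1) * coproduct K n (word K n l)))
          else 0 := by
      rw [word_cons, map_mul, coproduct_gen, add_mul, map_add, lTensor_left, lTensor_eta_left,
        mul_add, ← mul_assoc]
      split_ifs
      · rw [tensor_mul_neg, ← mul_assoc, ← mul_assoc]; simp
      · simp
    have h3 : (gen K n i ⊗ₜ[K] (1 : Ass K n)) * ((a ⊗ₜ[K] 1) * coproduct K n (word K n l)) =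
        ((gen K n i * a) ⊗ₜ[K] 1) * coproduct K n (word K n l) := by
      rw [← mul_assoc]; simp
    rw [h1, h2, map_add, map_add, ih, add_comm]
    congr 1
    split_ifs
    · rw [map_neg, closeUp_left, h3, closeUp_coproduct_left, closeUp_coproduct_left]
      simp [cutL, lmul, tr_mul_comm K n (gen K n i) a, sub_eq_add_neg, add_comm]
    · simp

theorem closeUp_eta_right (i : Fin n) (l : List (Fin n)) : ∀ a : Ass K n,
    closeUp K n (LinearMap.lTensor (Ass K n) ((etaBil K n).flip (gen K n i))
      (coproduct K n (word K n l)) * (a ⊗ₜ 1)) = cutR K n i (splitAt K n i l * (1 ⊗ₜ a)) := by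
  induction l using List.reverseRecOn with
  | nil =>
    intro a
    have : etaBil K n 1 (gen K n i) = 0 := by
      rw [← word_single, ← word_nil, etaBil, onWords_word, onWords_word]; simp [etaWord]
    simp [word_nil, splitAt, Algebra.TensorProduct.one_def, this]
  | append_singleton l j ih =>
    intro a
    have h1 : splitAt K n i (l ++ [j]) * ((1 : Ass K n) ⊗ₜ[K] a) =
        (if j = i then word K n l ⊗ₜ[K] a else 0) +
          splitAt K n i l * (1 ⊗ₜ[K] (gen K n j * a)) := by
      rw [splitAt_append_single, add_mul, mul_assoc]
      split_ifs <;> simp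
    have h2 : LinearMap.lTensor (Ass K n) ((etaBil K n).flip (gen K n i))
        (coproduct K n (word K n (l ++ [j]))) * (a ⊗ₜ[K] (1 : Ass K n)) =
        LinearMap.lTensor (Ass K n) ((etaBil K n).flip (gen K n i))
          (coproduct K n (word K n l)) * ((gen K n j * a) ⊗ₜ[K] 1) +
        if j = i then -((coproduct K n (word K n l) * (a ⊗ₜ[K] 1)) * (1 ⊗ₜ[K] gen K n i))
          else 0 := by
      rw [word_append, word_single, map_mul, coproduct_gen, mul_add, map_add, lTensor_right,
        lTensor_eta_right, add_mul, mul_assoc]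
      split_ifs
      · rw [tensor_neg_mul, mul_assoc, mul_assoc]; simp
      · simp
    have h3 : (coproduct K n (word K n l) * (a ⊗ₜ[K] 1)) * (gen K n i ⊗ₜ[K] (1 : Ass K n)) =
        coproduct K n (word K n l) * ((a * gen K n i) ⊗ₜ[K] 1) := by
      rw [mul_assoc]; simp
    rw [h1, h2, map_add, map_add, ih, add_comm]
    congr 1
    split_ifs
    · rw [map_neg, closeUp_right, h3, closeUp_coproduct_right, closeUp_coproduct_right]
      simp [cutR, rmul, sub_eq_add_neg, add_comm]
    · simp

theorem murGr_gen_mul (i : Fin n) (a : Ass K n) :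
    murGr K n (gen K n i * a) = lmul K n i (murGr K n a) +
      closeUp K n (LinearMap.lTensor (Ass K n) (etaBil K n (gen K n i)) (coproduct K n a)) := by
  have h : ∀ t : Ass K n ⊗[K] Ass K n,
      LinearMap.lTensor (Ass K n) (muGr K n) ((1 ⊗ₜ gen K n i) * t) =
        (1 ⊗ₜ gen K n i) * LinearMap.lTensor (Ass K n) (muGr K n) t +
          LinearMap.lTensor (Ass K n) (etaBil K n (gen K n i)) t := by
    intro t
    induction t with
    | zero => simp
    | add s t hs ht => simp only [mul_add, map_add, hs, ht]; abel
    | tmul p q => simp [muGr_gen_mul, TensorProduct.tmul_add]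
  simp only [murGr, LinearMap.comp_apply, AlgHom.toLinearMap_apply, map_mul, coproduct_gen,
    add_mul, map_add, lTensor_left, h, closeUp_left]
  abel

theorem murGr_mul_gen (i : Fin n) (a : Ass K n) :
    murGr K n (a * gen K n i) = rmul K n i (murGr K n a) +
      closeUp K n
        (LinearMap.lTensor (Ass K n) ((etaBil K n).flip (gen K n i)) (coproduct K n a)) := by
  have h : ∀ t : Ass K n ⊗[K] Ass K n,
      LinearMap.lTensor (Ass K n) (muGr K n) (t * (1 ⊗ₜ gen K n i)) =
        LinearMap.lTensor (Ass K n) (muGr K n) t * (1 ⊗ₜ gen K n i) +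
          LinearMap.lTensor (Ass K n) ((etaBil K n).flip (gen K n i)) t := by
    intro t
    induction t with
    | zero => simp
    | add s t hs ht => simp only [add_mul, map_add, hs, ht]; abel
    | tmul p q => simp [muGr_mul_gen, TensorProduct.tmul_add]
  simp only [murGr, LinearMap.comp_apply, AlgHom.toLinearMap_apply, map_mul, coproduct_gen,
    mul_add, map_add, lTensor_right, h, closeUp_right]
  abel

theorem tr_lmul_eq_tr_rmul (i : Fin n) (t : Tr K n ⊗[K] Ass K n) :
    LinearMap.lTensor (Tr K n) (tr K n) (lmul K n i t) =
      LinearMap.lTensor (Tr K n) (tr K n) (rmul K n i t) := by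
  induction t with
  | zero => simp
  | add s t hs ht => simp only [map_add, hs, ht]
  | tmul p q => simp [lmul, rmul, tr_mul_comm K n q]

theorem alt_cut (i : Fin n) (t : Ass K n ⊗[K] Ass K n) :
    alt K (Tr K n) (LinearMap.lTensor (Tr K n) (tr K n) (cutL K n i t)) =
      alt K (Tr K n) (LinearMap.lTensor (Tr K n) (tr K n) (cutR K n i t)) := by
  induction t with
  | zero => simp
  | add s t hs ht => simp only [map_add, hs, ht]
  | tmul p q =>
    simp [alt, cutL, cutR, tr_mul_comm K n q]
    abel

theorem deltaLift_gen_mul (i : Fin n) (a : Ass K n) :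
    deltaLift K n (gen K n i * a) = deltaLift K n (a * gen K n i) := by
  have : deltaLift K n ∘ₗ LinearMap.mulLeft K (gen K n i) =
      deltaLift K n ∘ₗ LinearMap.mulRight K (gen K n i) := by
    refine ext_words K n fun l => ?_
    have hl := closeUp_eta_left K n i l 1
    have hr := closeUp_eta_right K n i l 1
    rw [← Algebra.TensorProduct.one_def, one_mul, one_mul] at hl
    rw [← Algebra.TensorProduct.one_def, mul_one, mul_one] at hr
    simp only [deltaLift, LinearMap.comp_apply, LinearMap.mulLeft_apply,
      LinearMap.mulRight_apply, murGr_gen_mul, murGr_mul_gen, map_add, hl, hr, alt_cut,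
      tr_lmul_eq_tr_rmul]
  exact LinearMap.congr_fun this a

theorem deltaLift_mul_comm (a b : Ass K n) :
    deltaLift K n (a * b) = deltaLift K n (b * a) := by
  induction a using FreeAlgebra.induction generalizing b with
  | grade0 r => rw [Algebra.commutes]
  | grade1 i => exact deltaLift_gen_mul K n i b
  | mul a c ha hc => rw [mul_assoc, ha, mul_assoc, hc, mul_assoc]
  | add a c ha hc => rw [add_mul, mul_add, map_add, map_add, ha, hc]

end descent

/-- The linearized framed Turaev cobracket `δ^f_gr : tr_n → tr_n ⊗ tr_n`, determined by
`δ^f_gr(|a|) = (Alt ∘ (id ⊗ | |) ∘ μ^f_{r,gr})(a)`. -/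
def deltaGr : Tr K n →ₗ[K] Tr K n ⊗[K] Tr K n :=
  (commutators K n).liftQ (deltaLift K n) <| Submodule.span_le.2 <| by
    rintro _ ⟨a, b, rfl⟩
    simp [deltaLift_mul_comm K n a b]

theorem deltaGr_tr (a : Ass K n) : deltaGr K n (tr K n a) = deltaLift K n a := rfl

/-! ### Tangential derivations -/

/-- The canonical map `lie_n → ass_n` from the free Lie algebra, sending generators to
generators. -/
def lieToAss : FreeLieAlgebra K (Fin n) →ₗ⁅K⁆ Ass K n := FreeLieAlgebra.lift K (gen K n)

/-- `tder_n = lie_n^{⊕ n}`: the tangential derivations `(u_1, …, u_n)`. -/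
abbrev TDer : Type _ := Fin n → FreeLieAlgebra K (Fin n)

variable {K n}

/-- The algebra map `a ↦ (a, ρ(u)(a))` to the trivial square-zero extension of `ass_n` by
itself. -/
def rhoAux (u : TDer K n) : Ass K n →ₐ[K] TrivSqZeroExt (Ass K n) (Ass K n) :=
  FreeAlgebra.lift K fun i =>
    TrivSqZeroExt.inl (gen K n i) + TrivSqZeroExt.inr ⁅gen K n i, lieToAss K n (u i)⁆

/-- The action of `u = (u_1, …, u_n)` on `ass_n`: the derivation with `ρ(u)(x_i) = [x_i, u_i]`. -/
def rho (u : TDer K n) : Ass K n →ₗ[K] Ass K n :=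
  { toFun := fun a => (rhoAux u a).snd
    map_add' := by simp
    map_smul' := by simp }

theorem rho_gen (u : TDer K n) (i : Fin n) :
    rho u (gen K n i) = ⁅gen K n i, lieToAss K n (u i)⁆ := by
  simp [rho, rhoAux]

theorem rho_mul (u : TDer K n) (a b : Ass K n) :
    rho u (a * b) = rho u a * b + a * rho u b := by
  have h : ∀ c, (rhoAux u c).fst = c := by
    intro c
    have : (TrivSqZeroExt.fstHom K (Ass K n) (Ass K n)).comp (rhoAux u) = AlgHom.id K _ := by
      ext i; simp [rhoAux]
    exact DFunLike.congr_fun this c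
  simp [rho, h, add_comm]

/-- The action of `u` on `tr_n`, induced by `ρ(u)`. -/
def rhoTr (u : TDer K n) : Tr K n →ₗ[K] Tr K n :=
  (commutators K n).liftQ (tr K n ∘ₗ rho u) <| Submodule.span_le.2 <| by
    rintro _ ⟨a, b, rfl⟩
    simp [rho_mul, tr_mul_comm K n (rho u a), tr_mul_comm K n a, add_comm]

theorem rhoTr_tr (u : TDer K n) (a : Ass K n) : rhoTr u (tr K n a) = tr K n (rho u a) := rfl

/-- The action `D ⊗ id + id ⊗ D` on `V ⊗ V` induced by an endomorphism `D` of `V`. -/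
def tensorAct {V : Type*} [AddCommGroup V] [Module K V] (D : V →ₗ[K] V) :
    V ⊗[K] V →ₗ[K] V ⊗[K] V :=
  LinearMap.rTensor V D + LinearMap.lTensor V D

/-! ### Divergence and the Kashiwara–Vergne Lie algebras -/

variable (K n)

/-- On words: `∂_i (a_1 ⋯ a_m) = a_1 ⋯ a_{m-1}` if `a_m = x_i`, and `0` otherwise. -/
def partialWord (i : Fin n) (w : List (Fin n)) : Ass K n :=
  if w.getLast? = some i then word K n w.dropLast else 0

/-- The operators `∂_i` with `a = ε(a) + ∑_i (∂_i a) x_i`. -/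
def partialD (i : Fin n) : Ass K n →ₗ[K] Ass K n := onWords K n (partialWord K n i)

variable {K n}

/-- The divergence `div(u) = ∑_i |x_i (∂_i u_i)|`. -/
def divergence (u : TDer K n) : Tr K n :=
  ∑ i, tr K n (gen K n i * partialD K n i (lieToAss K n (u i)))

variable (K n)

/-- The part of `tr_n` of degree at least `N`: the span of the cyclic words of length `≥ N`. -/
def trGE (N : ℕ) : Submodule K (Tr K n) :=
  Submodule.span K {t | ∃ l : List (Fin n), N ≤ l.length ∧ t = tr K n (word K n l)}

/-- The special derivations: `u` with `ρ(u)(x_0) = 0`. -/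
def sder : Set (TDer K n) := {u | rho u (gen₀ K n) = 0}

/-- The Kashiwara–Vergne Lie algebra `krv_n`: the special derivations `u` such that
`div(u) = |f_0(x_0)| + ∑_{i=1}^n |f_i(x_i)|` for some formal power series `f_0, f_1, …, f_n`.
The equation is one in the degree completion of `tr_n`, that is, it holds modulo degree `≥ N`
for every `N`. -/
def krv : Set (TDer K n) :=
  {u | u ∈ sder K n ∧ ∃ (f₀ : PowerSeries K) (f : Fin n → PowerSeries K), ∀ N : ℕ,
    divergence u - (tr K n (Polynomial.aeval (gen₀ K n) (PowerSeries.trunc N f₀)) +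
      ∑ i, tr K n (Polynomial.aeval (gen K n i) (PowerSeries.trunc N (f i)))) ∈ trGE K n N}

/-- `krv_n^0`: the special derivations `u` such that `div(u)` is a linear combination of
`|x_1|, …, |x_n|`. -/
def krv₀ : Set (TDer K n) :=
  {u | u ∈ sder K n ∧ divergence u ∈ Submodule.span K (Set.range fun i => tr K n (gen K n i))}

end KV

end

noncomputable section

namespace KV

variable {K : Type*} [Field K] {n : ℕ}

attribute [local instance 100] LieRing.ofAssociativeRing

/-! ### Coefficients of words -/

section

/-! Everything is read off from the coefficients of words, and both equivalences pass through the
residues `r_i = ∂_i u_i - μ(u_i)` (`muResidue`).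

Commuting with `η` is the same as being special (`mem_sder_iff_commutesEta`). On positive degree
`η(x_0, ·)` and `η(·, x_0)` are both `-id`, so evaluating at `(x_0, x_0)` gives `ρ(u)(x_0) = 0`.
Conversely, `u` is special exactly when `∑ x_i u_i = ∑ u_i x_i`, and contracting this element with
`η` at both ends gives the identity needed on generators; Fox-type product rules do the rest.

Let `u` be special. Since `μ(ab) = a μ(b) + μ(a) b + η(a, b)`, the commutator `D = [ρ(u), μ]` is a
derivation, and `D(x_i) = [x_i, r_i]` (`muDefect_gen`). On the other hand the coefficient of
`div(u)` at the cyclic word `x_i w` is the coefficient of `w` in `r_i` (`cycCoef_divergence`). In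
characteristic zero these cyclic coefficients determine an element of `tr_n` without constant term.
Hence `u ∈ krv_n^0` means that every `r_i` is constant, and `u ∈ krv_n` means that, away from the
powers of `x_i`, the coefficients of `r_i` depend only on the length of the word, through one
function `β` common to all `i`.

For `μ`: `D = 0` iff each `r_i` lies in the centralizer `K[x_i]`; the non-constant powers of `x_i`
never occur in `r_i` because `u_i` is a Lie element.

For `δ`: all ingredients other than `μ` are equivariant, so the failure of `δ` to commute with
`ρ(u)` is obtained from `D`. If `u ∈ krv_n`, then `D` is the inner derivation `[·, b]` with `b` a
polynomial in `x_0`, and the failure vanishes after passing to traces. Conversely, applying the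
augmentation to one factor gives `|D(a)| = 0` for all `a`. Taking `a = x_i^N x_j^N` with `N` large
separates the coefficients of `r_j - r_i` (`coef_residue_sub`); together with the cyclic symmetry
`coef_residue_rotate` this forces dependence on the length alone. -/

theorem span_range_word : Submodule.span K (Set.range (word K n)) = ⊤ := by
  rw [← (wordBasis K n).span_eq]
  congr 1
  ext a
  constructor
  · rintro ⟨l, rfl⟩
    exact ⟨FreeMonoid.ofList l, by rw [wordBasis_apply, FreeMonoid.toList_ofList]⟩
  · rintro ⟨w, rfl⟩
    exact ⟨FreeMonoid.toList w, (wordBasis_apply K n w).symm⟩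

/-- Induction along left multiplication by generators. -/
theorem left_induction {p : Ass K n → Prop} (one : p 1) (gen_mul : ∀ i a, p a → p (gen K n i * a))
    (add : ∀ a b, p a → p b → p (a + b)) (smul : ∀ (c : K) a, p a → p (c • a)) (a : Ass K n) :
    p a := by
  have ha : a ∈ Submodule.span K (Set.range (word K n)) := by
    rw [span_range_word]; exact Submodule.mem_top
  induction ha using Submodule.span_induction with
  | mem x h =>
    obtain ⟨l, rfl⟩ := h
    induction l with
    | nil => exact one
    | cons i l ih => rw [word_cons]; exact gen_mul _ _ ih
  | zero => simpa using smul 0 1 one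
  | add x y _ _ hx hy => exact add x y hx hy
  | smul c x _ hx => exact smul c x hx

/-- Induction along right multiplication by generators. -/
theorem right_induction {p : Ass K n → Prop} (one : p 1) (mul_gen : ∀ a i, p a → p (a * gen K n i))
    (add : ∀ a b, p a → p b → p (a + b)) (smul : ∀ (c : K) a, p a → p (c • a)) (a : Ass K n) :
    p a := by
  have ha : a ∈ Submodule.span K (Set.range (word K n)) := by
    rw [span_range_word]; exact Submodule.mem_top
  induction ha using Submodule.span_induction with
  | mem x h =>
    obtain ⟨l, rfl⟩ := h
    induction l using List.reverseRecOn with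
    | nil => exact one
    | append_singleton l i ih => rw [word_append, word_single]; exact mul_gen _ _ ih
  | zero => simpa using smul 0 1 one
  | add x y _ _ hx hy => exact add x y hx hy
  | smul c x _ hx => exact smul c x hx

/-- The coefficient of a word. -/
def coef (l : List (Fin n)) : Ass K n →ₗ[K] K :=
  onWords K n fun m => if m = l then 1 else 0

theorem coef_word (l m : List (Fin n)) : coef l (word K n m) = if m = l then 1 else 0 := by
  rw [coef, onWords_word]

theorem coef_eq_repr (l : List (Fin n)) (a : Ass K n) :
    coef l a = (wordBasis K n).repr a (FreeMonoid.ofList l) := by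
  have : coef l = (wordBasis K n).coord (FreeMonoid.ofList l) := by
    refine ext_words K n fun m => ?_
    have h := wordBasis_apply K n (FreeMonoid.ofList m)
    rw [FreeMonoid.toList_ofList] at h
    classical
    rw [coef_word, ← h, Module.Basis.coord_apply, Module.Basis.repr_self, Finsupp.single_apply]
    simp
  rw [this, Module.Basis.coord_apply]

theorem coef_one (l : List (Fin n)) : coef l (1 : Ass K n) = if l = [] then 1 else 0 := by
  rw [← word_nil, coef_word]; simp [eq_comm]

theorem coef_cons_gen_mul (i j : Fin n) (l : List (Fin n)) (a : Ass K n) :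
    coef (i :: l) (gen K n j * a) = if j = i then coef l a else 0 := by
  have : coef (i :: l) ∘ₗ LinearMap.mulLeft K (gen K n j) = if j = i then coef l else 0 := by
    refine ext_words K n fun m => ?_
    rw [LinearMap.comp_apply, LinearMap.mulLeft_apply, ← word_cons, coef_word]
    by_cases h : j = i <;> simp [h, coef_word]
  have h := LinearMap.congr_fun this a
  rw [LinearMap.comp_apply, LinearMap.mulLeft_apply] at h
  rw [h]; split_ifs <;> simp

theorem coef_snoc_mul_gen (i j : Fin n) (l : List (Fin n)) (a : Ass K n) :
    coef (l ++ [i]) (a * gen K n j) = if j = i then coef l a else 0 := by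
  have : coef (l ++ [i]) ∘ₗ LinearMap.mulRight K (gen K n j) = if j = i then coef l else 0 := by
    refine ext_words K n fun m => ?_
    rw [LinearMap.comp_apply, LinearMap.mulRight_apply, ← word_single, ← word_append, coef_word]
    by_cases h : j = i <;> simp [h, coef_word]
  have h := LinearMap.congr_fun this a
  rw [LinearMap.comp_apply, LinearMap.mulRight_apply] at h
  rw [h]; split_ifs <;> simp

/-- This makes `coef []` the augmentation `ε`, the counit in the product rules for `η`. -/
theorem coef_nil_mul (a b : Ass K n) : coef [] (a * b) = coef [] a * coef [] b := by
  induction a using left_induction with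
  | one => simp [coef_one]
  | gen_mul i a ih =>
    have h : ∀ c : Ass K n, coef [] (gen K n i * c) = 0 := by
      intro c
      induction c using right_induction with
      | one => rw [mul_one, ← word_single, coef_word]; simp
      | mul_gen a j ih =>
        have : coef [] ∘ₗ LinearMap.mulLeft K (gen K n i) = 0 := by
          refine ext_words K n fun m => ?_
          rw [LinearMap.comp_apply, LinearMap.mulLeft_apply, ← word_cons, coef_word]; simp
        exact LinearMap.congr_fun this _
      | add a b ha hb => rw [mul_add, map_add, ha, hb, add_zero]
      | smul c a ha => rw [mul_smul_comm, map_smul, ha, smul_zero]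
    rw [mul_assoc, h, h, zero_mul]
  | add a c ha hc => rw [add_mul, map_add, map_add, ha, hc, add_mul]
  | smul c a ha => rw [smul_mul_assoc, map_smul, map_smul, ha, smul_mul_assoc]

theorem coef_nil_gen (i : Fin n) : coef [] (gen K n i) = 0 := by
  rw [← word_single, coef_word]; simp

theorem coef_nil_gen_mul (i : Fin n) (a : Ass K n) : coef [] (gen K n i * a) = 0 := by
  rw [coef_nil_mul, coef_nil_gen, zero_mul]

theorem coef_nil_mul_gen (i : Fin n) (a : Ass K n) : coef [] (a * gen K n i) = 0 := by
  rw [coef_nil_mul, coef_nil_gen, mul_zero]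

theorem coef_gen_mul (j : Fin n) (l : List (Fin n)) (a : Ass K n) :
    coef l (gen K n j * a) = coef (l.rotate 1) (a * gen K n j) := by
  cases l with
  | nil => simp [coef_nil_gen_mul, coef_nil_mul_gen]
  | cons i l =>
    rw [List.rotate_cons_succ, List.rotate_zero, coef_cons_gen_mul, coef_snoc_mul_gen]

theorem coef_cons_sum (f : Fin n → Ass K n) (i : Fin n) (l : List (Fin n)) :
    coef (i :: l) (∑ j, gen K n j * f j) = coef l (f i) := by
  simp [map_sum, coef_cons_gen_mul]

theorem coef_snoc_sum (f : Fin n → Ass K n) (i : Fin n) (l : List (Fin n)) :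
    coef (l ++ [i]) (∑ j, f j * gen K n j) = coef l (f i) := by
  simp [map_sum, coef_snoc_mul_gen]

theorem coef_nil_gen₀ : coef [] (gen₀ K n) = 0 := by
  simp [gen₀, coef_nil_gen]

theorem coef_cons_gen₀_mul (i : Fin n) (l : List (Fin n)) (a : Ass K n) :
    coef (i :: l) (gen₀ K n * a) = coef l a := by
  rw [gen₀, Finset.sum_mul, coef_cons_sum]

theorem coef_gen₀_pow (m : ℕ) (l : List (Fin n)) :
    coef l (gen₀ K n ^ m) = if l.length = m then 1 else 0 := by
  induction m generalizing l with
  | zero => simp [coef_one]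
  | succ m ih =>
    cases l with
    | nil => simp [pow_succ, coef_nil_mul, coef_nil_gen₀]
    | cons i l => rw [pow_succ', coef_cons_gen₀_mul, ih]; simp

theorem gen_pow_eq_word (i : Fin n) (m : ℕ) :
    gen K n i ^ m = word K n (List.replicate m i) := by
  simp [word]

theorem coef_gen_pow (i : Fin n) (m : ℕ) (l : List (Fin n)) :
    coef l (gen K n i ^ m) = if l = List.replicate m i then 1 else 0 := by
  rw [gen_pow_eq_word, coef_word]; simp [eq_comm]

theorem exists_length_bound (a : Ass K n) :
    ∃ d, ∀ l : List (Fin n), d ≤ l.length → coef l a = 0 := by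
  induction a using left_induction with
  | one =>
    refine ⟨1, fun l hl => ?_⟩
    rw [coef_one, if_neg]
    rintro rfl
    simp at hl
  | gen_mul i a ih =>
    obtain ⟨d, hd⟩ := ih
    refine ⟨d + 1, fun l hl => ?_⟩
    cases l with
    | nil => exact coef_nil_gen_mul i a
    | cons j l => rw [coef_cons_gen_mul, hd l (by simpa using hl), ite_self]
  | add a b ha hb =>
    obtain ⟨d, hd⟩ := ha
    obtain ⟨e, he⟩ := hb
    refine ⟨d + e, fun l hl => ?_⟩
    rw [map_add, hd l (by omega), he l (by omega), add_zero]
  | smul c a ha =>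
    obtain ⟨d, hd⟩ := ha
    exact ⟨d, fun l hl => by rw [map_smul, hd l hl, smul_zero]⟩

theorem mem_of_coef {V : Type*} [AddCommGroup V] [Module K V] (f : Ass K n →ₗ[K] V)
    (S : Submodule K V) (a : Ass K n) (h : ∀ l, coef l a ≠ 0 → f (word K n l) ∈ S) : f a ∈ S := by
  rw [← (wordBasis K n).linearCombination_repr a, Finsupp.linearCombination_apply, Finsupp.sum,
    map_sum]
  refine Submodule.sum_mem _ fun w hw => ?_
  rw [map_smul, wordBasis_apply]
  refine S.smul_mem _ (h _ ?_)
  rw [coef_eq_repr, FreeMonoid.ofList_toList]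
  exact Finsupp.mem_support_iff.1 hw

/-- The centralizer of `x_i` is `K[x_i]`. Comparing coefficients in `x_i q = q x_i` shows that a
trailing block of `x_i` may be moved to the front of a word. A word that is not a power of `x_i`
thereby becomes a word `v` ending in another letter; then `x_i v` does not occur in `q x_i`, while
its coefficient in `x_i q` is that of `v` in `q`. -/
theorem commute_gen_iff (i : Fin n) (q : Ass K n) :
    gen K n i * q = q * gen K n i ↔
      ∀ l : List (Fin n), l ≠ List.replicate l.length i → coef l q = 0 := by
  constructor
  · intro h l
    have key : ∀ (m : ℕ) (l : List (Fin n)), coef (List.replicate m i ++ l) q =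
        coef (l ++ List.replicate m i) q := by
      intro m
      induction m with
      | zero => simp
      | succ m ih =>
        intro l
        have h1 : coef (i :: (List.replicate m i ++ l)) q =
            coef ((List.replicate m i ++ l) ++ [i]) q := by
          have := congrArg (coef (i :: ((List.replicate m i ++ l) ++ [i]))) h
          rw [coef_cons_gen_mul, if_pos rfl, ← List.cons_append, coef_snoc_mul_gen,
            if_pos rfl] at this
          exact this.symm
        rw [List.replicate_succ, List.cons_append, h1, List.append_assoc, ih]
        simp
    induction l using List.reverseRecOn with
    | nil => simp
    | append_singleton l j ih =>
      intro hl
      by_cases hj : j = i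
      · subst hj
        obtain ⟨m, l', k, hk, rfl⟩ : ∃ (m : ℕ) (l' : List (Fin n)) (k : Fin n), k ≠ j ∧
            l = l' ++ [k] ++ List.replicate m j := by
          clear ih
          induction l using List.reverseRecOn with
          | nil => simp at hl
          | append_singleton l k ih =>
            by_cases hk : k = j
            · subst hk
              obtain ⟨m, l', k', hk', rfl⟩ := ih (fun h0 => hl (by
                rw [h0]; simp [← List.replicate_succ']))
              exact ⟨m + 1, l', k', hk', by simp [List.replicate_succ']⟩
            · exact ⟨0, l, k, hk, by simp⟩
        rw [List.append_assoc, ← List.replicate_succ', ← key, ← List.append_assoc]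
        have := congrArg (coef (j :: (List.replicate (m + 1) j ++ l' ++ [k]))) h
        rw [coef_cons_gen_mul, if_pos rfl, ← List.cons_append, coef_snoc_mul_gen,
          if_neg (Ne.symm hk)] at this
        exact this
      · have := congrArg (coef (i :: (l ++ [j]))) h
        rw [coef_cons_gen_mul, if_pos rfl, ← List.cons_append, coef_snoc_mul_gen,
          if_neg (Ne.symm hj)] at this
        exact this
  · intro h
    have hm : (LinearMap.id : Ass K n →ₗ[K] Ass K n) q ∈
        Submodule.span K (Set.range fun m : ℕ => gen K n i ^ m) := by
      refine mem_of_coef _ _ _ fun l hl => ?_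
      have : l = List.replicate l.length i := by
        by_contra hne
        exact hl (h l hne)
      rw [LinearMap.id_apply, this, ← gen_pow_eq_word]
      exact Submodule.subset_span ⟨_, rfl⟩
    rw [LinearMap.id_apply] at hm
    clear h
    induction hm using Submodule.span_induction with
    | mem x hx =>
      obtain ⟨m, rfl⟩ := hx
      exact (pow_succ' _ _).symm.trans (pow_succ _ _)
    | zero => simp
    | add x y _ _ hx hy => rw [mul_add, add_mul, hx, hy]
    | smul c x _ hx => rw [mul_smul_comm, smul_mul_assoc, hx]

end

/-! ### The forms `η_gr` and `μ^f_gr` on products -/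

section

theorem etaBil_one_left (a : Ass K n) : etaBil K n 1 a = 0 := by
  have : etaBil K n 1 = 0 := by
    refine ext_words K n fun l => ?_
    rw [← word_nil, etaBil, onWords_word, onWords_word]
    simp [etaWord]
  rw [this, LinearMap.zero_apply]

theorem etaBil_one_right (a : Ass K n) : etaBil K n a 1 = 0 := by
  have : (etaBil K n).flip 1 = 0 := by
    refine ext_words K n fun l => ?_
    rw [LinearMap.flip_apply, ← word_nil, etaBil, onWords_word, onWords_word]
    cases h : l.getLast? <;> simp [etaWord, h]
  rw [← LinearMap.flip_apply, this, LinearMap.zero_apply]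

theorem etaBil_gen_gen (i j : Fin n) :
    etaBil K n (gen K n i) (gen K n j) = if j = i then -gen K n i else 0 := by
  have := etaBil_gen_mul K n i j 1
  simpa using this

theorem etaBil_mul_gen_gen_mul (i j : Fin n) (a b : Ass K n) :
    etaBil K n (a * gen K n i) (gen K n j * b) =
      if j = i then -(a * gen K n i * b) else 0 := by
  have : (etaBil K n ∘ₗ LinearMap.mulRight K (gen K n i)).compl₂ (LinearMap.mulLeft K (gen K n j)) =
      if j = i then -(LinearMap.mul K (Ass K n) ∘ₗ LinearMap.mulRight K (gen K n i)) else 0 := by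
    refine ext_words K n fun l => ext_words K n fun m => ?_
    rw [LinearMap.compl₂_apply, LinearMap.comp_apply, LinearMap.mulLeft_apply,
      LinearMap.mulRight_apply, ← word_cons, ← word_single, ← word_append, etaBil, onWords_word,
      onWords_word]
    by_cases h : j = i
    · simp [h, etaWord, zz, word_single]
    · simp [h, etaWord, zz, Ne.symm h]
  have h := LinearMap.congr_fun (LinearMap.congr_fun this a) b
  rw [LinearMap.compl₂_apply, LinearMap.comp_apply, LinearMap.mulLeft_apply,
    LinearMap.mulRight_apply] at h
  rw [h]
  split_ifs <;> simp

/-- A Fox-type rule: only the last letter of the left argument matters, and it comes from `a` only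
for the constant part of `b`. -/
theorem etaBil_mul_left (a b c : Ass K n) :
    etaBil K n (a * b) c = a * etaBil K n b c + coef [] b • etaBil K n a c := by
  induction b using right_induction with
  | one => simp [coef_one, etaBil_one_left]
  | add x y hx hy => simp only [mul_add, map_add, LinearMap.add_apply, hx, hy, add_smul]; abel
  | smul r x hx => simp only [mul_smul_comm, map_smul, LinearMap.smul_apply, hx, smul_add,
      smul_assoc]
  | mul_gen b i ih =>
    clear ih
    rw [coef_nil_mul_gen, zero_smul, add_zero, ← mul_assoc]
    induction c using left_induction with
    | one => simp [etaBil_one_right]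
    | add x y hx hy => simp only [mul_add, map_add, hx, hy]
    | smul r x hx => simp only [mul_smul_comm, map_smul, hx]
    | gen_mul j c =>
      rw [etaBil_mul_gen_gen_mul, etaBil_mul_gen_gen_mul]
      split_ifs <;> simp [mul_assoc]

theorem etaBil_mul_right (a b c : Ass K n) :
    etaBil K n a (b * c) = etaBil K n a b * c + coef [] b • etaBil K n a c := by
  induction b using left_induction with
  | one => simp [coef_one, etaBil_one_right]
  | add x y hx hy => simp only [add_mul, map_add, hx, hy, add_smul]; abel
  | smul r x hx => simp only [smul_mul_assoc, map_smul, hx, smul_add, smul_assoc]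
  | gen_mul i b ih =>
    clear ih
    rw [coef_nil_gen_mul, zero_smul, add_zero, mul_assoc]
    induction a using right_induction with
    | one => simp [etaBil_one_left]
    | add x y hx hy => simp only [add_mul, map_add, LinearMap.add_apply, hx, hy]
    | smul r x hx => simp only [smul_mul_assoc, map_smul, LinearMap.smul_apply, hx]
    | mul_gen a j =>
      rw [etaBil_mul_gen_gen_mul, etaBil_mul_gen_gen_mul]
      split_ifs <;> simp [mul_assoc]

/-- The two contractions act on opposite ends of a word, so they can be done in either order.
Applied to `∑ x_i u_i`, this turns cyclic invariance into `etaBil_lieToAss_mul_gen`. -/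
theorem etaBil_gen_etaBil (i j : Fin n) (a : Ass K n) :
    etaBil K n (gen K n i) (etaBil K n a (gen K n j)) =
      etaBil K n (etaBil K n (gen K n i) a) (gen K n j) := by
  induction a using left_induction with
  | one => simp [etaBil_one_left, etaBil_one_right]
  | add x y hx hy => simp only [map_add, LinearMap.add_apply, hx, hy]
  | smul r x hx => simp only [map_smul, LinearMap.smul_apply, hx]
  | gen_mul k a =>
    rw [etaBil_mul_left, map_add, map_smul, etaBil_gen_mul, etaBil_gen_mul, etaBil_gen_gen]
    by_cases hk : k = i
    · subst hk
      simp only [if_true, map_neg, LinearMap.neg_apply, etaBil_mul_left, etaBil_gen_gen]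
      split_ifs with hj
      · subst hj; simp [etaBil_gen_gen, add_comm]
      · simp
    · simp only [hk, if_false, map_zero, LinearMap.zero_apply, zero_add]
      split_ifs with hj
      · rw [map_neg, etaBil_gen_gen, if_neg hk]; simp
      · simp

theorem etaBil_sum_gen_mul (f : Fin n → Ass K n) (i : Fin n) :
    etaBil K n (gen K n i) (∑ j, gen K n j * f j) = -(gen K n i * f i) := by
  simp [map_sum, etaBil_gen_mul]

theorem etaBil_sum_mul_gen (f : Fin n → Ass K n) (i : Fin n) :
    etaBil K n (∑ j, f j * gen K n j) (gen K n i) = -(f i * gen K n i) := by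
  simp [map_sum, LinearMap.sum_apply, etaBil_mul_gen]

/-- Exactly one summand of `x_0` matches the first letter of a nonempty word. -/
theorem etaBil_gen₀_left (a : Ass K n) : etaBil K n (gen₀ K n) a = -(a - coef [] a • 1) := by
  induction a using left_induction with
  | one => simp [etaBil_one_right, coef_one]
  | add x y hx hy => simp only [map_add, hx, hy, add_smul]; abel
  | smul r x hx => simp only [map_smul, hx, smul_neg, smul_sub, smul_assoc]
  | gen_mul i a => simp [gen₀, LinearMap.sum_apply, etaBil_gen_mul, coef_nil_gen_mul]

theorem etaBil_gen₀_right (a : Ass K n) : etaBil K n a (gen₀ K n) = -(a - coef [] a • 1) := by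
  induction a using right_induction with
  | one => simp [etaBil_one_left, coef_one]
  | add x y hx hy => simp only [map_add, LinearMap.add_apply, hx, hy, add_smul]; abel
  | smul r x hx => simp only [map_smul, LinearMap.smul_apply, hx, smul_neg, smul_sub, smul_assoc]
  | mul_gen a i => simp [gen₀, etaBil_mul_gen, coef_nil_mul_gen]

theorem muGr_one : muGr K n 1 = 0 := by
  rw [← word_nil, muGr, onWords_word, muWord]

/-- Two adjacent letters of a product of words lie in the first word, in the second, or across the
junction; `η` accounts for the last case. -/
theorem muGr_mul (a b : Ass K n) :
    muGr K n (a * b) = a * muGr K n b + muGr K n a * b + etaBil K n a b := by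
  induction a using left_induction generalizing b with
  | one => simp [muGr_one, etaBil_one_left]
  | add x y hx hy => simp only [add_mul, map_add, LinearMap.add_apply, hx, hy]; abel
  | smul r x hx => simp only [smul_mul_assoc, map_smul, LinearMap.smul_apply, hx, smul_add]
  | gen_mul i a ih =>
    rw [mul_assoc, muGr_gen_mul, ih, muGr_gen_mul, etaBil_mul_left, etaBil_mul_right]
    noncomm_ring

theorem partialD_mul_gen (i j : Fin n) (a : Ass K n) :
    partialD K n i (a * gen K n j) = if j = i then a else 0 := by
  have : partialD K n i ∘ₗ LinearMap.mulRight K (gen K n j) =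
      if j = i then LinearMap.id else 0 := by
    refine ext_words K n fun l => ?_
    rw [LinearMap.comp_apply, LinearMap.mulRight_apply, ← word_single, ← word_append, partialD,
      onWords_word, partialWord]
    by_cases h : j = i <;> simp [h]
  have h := LinearMap.congr_fun this a
  rw [LinearMap.comp_apply, LinearMap.mulRight_apply] at h
  rw [h]
  split_ifs <;> simp

theorem partialD_one (i : Fin n) : partialD K n i 1 = 0 := by
  rw [← word_nil, partialD, onWords_word, partialWord]; simp

theorem etaBil_gen_right (a : Ass K n) (i : Fin n) :
    etaBil K n a (gen K n i) = -(partialD K n i a * gen K n i) := by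
  induction a using right_induction with
  | one => simp [etaBil_one_left, partialD_one]
  | add x y hx hy => simp only [map_add, LinearMap.add_apply, hx, hy, add_mul]; abel
  | smul r x hx => simp only [map_smul, LinearMap.smul_apply, hx, smul_neg, smul_mul_assoc]
  | mul_gen a j => rw [etaBil_mul_gen, partialD_mul_gen]; split_ifs <;> simp

theorem coef_partialD (i : Fin n) (l : List (Fin n)) (a : Ass K n) :
    coef l (partialD K n i a) = coef (l ++ [i]) a := by
  induction a using right_induction with
  | one => simp [partialD_one, coef_one]
  | add x y hx hy => simp only [map_add, hx, hy]
  | smul r x hx => simp only [map_smul, hx]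
  | mul_gen a j => rw [partialD_mul_gen, coef_snoc_mul_gen]; split_ifs <;> simp

/-- The coefficients of `μ^f_gr(a)` are sums over the ways of doubling a letter of the word. -/
theorem coef_muGr (l : List (Fin n)) (a : Ass K n) :
    coef l (muGr K n a) =
      -∑ k : Fin l.length, coef (l.take k ++ l[k] :: l.drop k) a := by
  induction l generalizing a with
  | nil =>
    induction a using left_induction with
    | one => simp [muGr_one]
    | add x y hx hy => simp only [map_add, hx, hy]; simp
    | smul r x hx => simp only [map_smul, hx]; simp
    | gen_mul i a =>
      have h : ∀ b : Ass K n, coef [] (etaBil K n (gen K n i) b) = 0 := by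
        intro b
        induction b using left_induction with
        | one => simp [etaBil_one_right]
        | add x y hx hy => simp only [map_add, hx, hy, add_zero]
        | smul r x hx => simp only [map_smul, hx, smul_zero]
        | gen_mul j b =>
          rw [etaBil_gen_mul]
          split_ifs
          · rw [map_neg, coef_nil_gen_mul, neg_zero]
          · simp
      simp [muGr_gen_mul, coef_nil_gen_mul, h]
  | cons j l ih =>
    have hs : ∀ a : Ass K n,
        ∑ k : Fin (j :: l).length, coef ((j :: l).take k ++ (j :: l)[k] :: (j :: l).drop k) a =
          coef (j :: j :: l) a +
            ∑ k : Fin l.length, coef (j :: (l.take k ++ l[k] :: l.drop k)) a :=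
      fun a => Fin.sum_univ_succ _
    rw [hs]
    clear hs
    induction a using left_induction with
    | one => simp [muGr_one, coef_one]
    | add x y hx hy => simp only [map_add, hx, hy, Finset.sum_add_distrib]; ring
    | smul r x hx => simp only [map_smul, hx, ← Finset.smul_sum, smul_add, smul_neg]
    | gen_mul i a =>
      have h : ∀ b : Ass K n, coef (j :: l) (etaBil K n (gen K n i) b) =
          -(if i = j then coef (j :: l) b else 0) := by
        intro b
        induction b using left_induction with
        | one => simp [etaBil_one_right, coef_one]
        | add x y hx hy => simp only [map_add, hx, hy]; split_ifs <;> ring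
        | smul r x hx => simp only [map_smul, hx, smul_neg, smul_ite, smul_zero]
        | gen_mul k b =>
          rw [etaBil_gen_mul, coef_cons_gen_mul]
          by_cases hk : k = i
          · subst hk; by_cases h : k = j <;> simp [h, coef_cons_gen_mul]
          · by_cases hij : i = j
            · subst hij; simp [hk]
            · simp [hk, hij]
      rw [muGr_gen_mul, map_add, coef_cons_gen_mul, ih, h]
      by_cases hij : i = j
      · subst hij; simp [coef_cons_gen_mul]
      · simp [coef_cons_gen_mul, hij]

end

/-! ### Lie elements and tangential derivations -/

section

theorem lieToAss_induction {p : Ass K n → Prop} (gen : ∀ i, p (gen K n i))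
    (add : ∀ a b, p a → p b → p (a + b)) (smul : ∀ (c : K) a, p a → p (c • a))
    (lie : ∀ a b, p a → p b → p (a * b - b * a)) (zero : p 0) (f : FreeLieAlgebra K (Fin n)) :
    p (lieToAss K n f) := by
  let S : LieSubalgebra K (Ass K n) :=
    { carrier := {a | p a}
      add_mem' := fun ha hb => add _ _ ha hb
      zero_mem' := zero
      smul_mem' := fun c _ ha => smul c _ ha
      lie_mem' := fun ha hb => by
        rw [LieRing.of_associative_ring_bracket]; exact lie _ _ ha hb }
  let g : FreeLieAlgebra K (Fin n) →ₗ⁅K⁆ S := FreeLieAlgebra.lift K fun i => ⟨_, gen i⟩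
  have h : lieToAss K n = S.incl.comp g := by
    refine FreeLieAlgebra.hom_ext fun i => ?_
    simp [lieToAss, g]
  rw [h]
  exact (g f).2

variable (f : FreeLieAlgebra K (Fin n))

theorem coef_nil_lieToAss : coef [] (lieToAss K n f) = 0 := by
  refine lieToAss_induction (p := fun a => coef [] a = 0) coef_nil_gen ?_ ?_ ?_ (map_zero _) f
  · intro a b ha hb; rw [map_add, ha, hb, add_zero]
  · intro c a ha; rw [map_smul, ha, smul_zero]
  · intro a b ha hb; rw [map_sub, coef_nil_mul, coef_nil_mul, ha, hb, mul_zero, sub_zero]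

theorem coproduct_lieToAss :
    coproduct K n (lieToAss K n f) = lieToAss K n f ⊗ₜ 1 + 1 ⊗ₜ lieToAss K n f := by
  refine lieToAss_induction (p := fun a => coproduct K n a = a ⊗ₜ 1 + 1 ⊗ₜ a)
    (coproduct_gen K n) ?_ ?_ ?_ (by simp) f
  · intro a b ha hb
    rw [map_add, ha, hb, TensorProduct.add_tmul, TensorProduct.tmul_add]; abel
  · intro c a ha
    rw [map_smul, ha, smul_add, TensorProduct.smul_tmul', TensorProduct.tmul_smul]
  · intro a b ha hb
    simp only [map_sub, map_mul, ha, hb, mul_add, add_mul, Algebra.TensorProduct.tmul_mul_tmul,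
      mul_one, one_mul, TensorProduct.sub_tmul, TensorProduct.tmul_sub]
    abel

theorem antipode_lieToAss : antipode K n (lieToAss K n f) = -lieToAss K n f := by
  refine lieToAss_induction (p := fun a => antipode K n a = -a) (antipode_gen K n) ?_ ?_ ?_
    (by simp) f
  · intro a b ha hb; rw [map_add, ha, hb, neg_add]
  · intro c a ha; rw [map_smul, ha, smul_neg]
  · intro a b ha hb
    rw [map_sub, antipode_mul, antipode_mul, ha, hb]; noncomm_ring

/-- A Lie element has no component along `x_i^k` for `k ≥ 2`. -/
theorem coef_replicate_lieToAss (i : Fin n) (k : ℕ) (hk : 2 ≤ k) :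
    coef (List.replicate k i) (lieToAss K n f) = 0 := by
  -- Send `x_i` to `X` and the other letters to `0`: the coefficients of the powers of `x_i` become
  -- those of a polynomial, and brackets die in a commutative ring, so a Lie element maps into `K
  -- X`.
  let π : Ass K n →ₐ[K] Polynomial K :=
    FreeAlgebra.lift K fun j => if j = i then Polynomial.X else 0
  have hπ : ∀ j, π (gen K n j) = if j = i then Polynomial.X else 0 := fun j => by simp [π]
  have hc : ∀ (a : Ass K n) (m : ℕ), (π a).coeff m = coef (List.replicate m i) a := by
    intro a
    induction a using left_induction with
    | one => intro m; simp [coef_one, Polynomial.coeff_one]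
    | add a b ha hb => intro m; simp [ha, hb]
    | smul c a ha => intro m; simp [ha]
    | gen_mul j a ih =>
      intro m
      rw [map_mul, hπ]
      cases m with
      | zero => split_ifs <;> simp [coef_nil_gen_mul]
      | succ m =>
        rw [List.replicate_succ, coef_cons_gen_mul]
        split_ifs
        · rw [Polynomial.coeff_X_mul, ih]
        · simp
  obtain ⟨c, h⟩ : ∃ c : K, π (lieToAss K n f) = c • Polynomial.X := by
    refine lieToAss_induction (p := fun a => ∃ c : K, π a = c • Polynomial.X) ?_ ?_ ?_ ?_
      ⟨0, by simp⟩ f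
    · intro j
      refine ⟨if j = i then 1 else 0, ?_⟩
      rw [hπ]; split_ifs <;> simp
    · rintro a b ⟨c, hc⟩ ⟨d, hd⟩
      exact ⟨c + d, by rw [map_add, hc, hd, add_smul]⟩
    · rintro r a ⟨c, hc⟩
      exact ⟨r * c, by rw [map_smul, hc, smul_smul]⟩
    · intro a b _ _
      exact ⟨0, by rw [map_sub, map_mul, map_mul, mul_comm, sub_self, zero_smul]⟩
  rw [← hc, h, Polynomial.coeff_smul, Polynomial.coeff_X, if_neg (by omega), smul_zero]

/-! ### Equivariance of the Hopf structure under `ρ(u)`, and the failure of equivariance of `δ`. -/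

variable (u : TDer K n)

theorem rho_gen' (i : Fin n) :
    rho u (gen K n i) = gen K n i * lieToAss K n (u i) - lieToAss K n (u i) * gen K n i := by
  rw [rho_gen, LieRing.of_associative_ring_bracket]

theorem rho_one : rho u 1 = 0 := by
  have := rho_mul u 1 1
  simpa using this

theorem coef_nil_rho (a : Ass K n) : coef [] (rho u a) = 0 := by
  induction a using left_induction with
  | one => simp [rho_one]
  | add a b ha hb => rw [map_add, map_add, ha, hb, add_zero]
  | smul c a ha => rw [map_smul, map_smul, ha, smul_zero]
  | gen_mul i a ih =>
    rw [rho_mul, map_add, coef_nil_mul, coef_nil_mul, rho_gen', map_sub, coef_nil_mul,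
      coef_nil_mul, coef_nil_gen]
    simp

theorem tensorAct_mul (s t : Ass K n ⊗[K] Ass K n) :
    tensorAct (rho u) (s * t) = tensorAct (rho u) s * t + s * tensorAct (rho u) t := by
  induction s with
  | zero => simp
  | add x y hx hy => simp only [add_mul, map_add, hx, hy]; abel
  | tmul a b =>
    induction t with
    | zero => simp
    | add x y hx hy => simp only [mul_add, map_add, hx, hy]; abel
    | tmul c d =>
      simp only [tensorAct, LinearMap.add_apply, Algebra.TensorProduct.tmul_mul_tmul,
        LinearMap.rTensor_tmul, LinearMap.lTensor_tmul, rho_mul, TensorProduct.add_tmul,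
        TensorProduct.tmul_add, add_mul, mul_add]
      abel

/-- `ρ(u)` is a coderivation because both `x_i` and the Lie element `u_i` are primitive. -/
theorem coproduct_rho (a : Ass K n) :
    coproduct K n (rho u a) = tensorAct (rho u) (coproduct K n a) := by
  induction a using left_induction with
  | one => simp [rho_one, tensorAct, Algebra.TensorProduct.one_def]
  | add a b ha hb => simp only [map_add, ha, hb]
  | smul c a ha => simp only [map_smul, ha]
  | gen_mul i a ih =>
    rw [rho_mul, map_add, map_mul, map_mul, map_mul, tensorAct_mul, ih]
    congr 2
    rw [rho_gen', map_sub, map_mul, map_mul, coproduct_lieToAss, coproduct_gen]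
    simp only [tensorAct, map_add, LinearMap.add_apply, LinearMap.rTensor_tmul,
      LinearMap.lTensor_tmul, rho_one, rho_gen', mul_add, add_mul,
      Algebra.TensorProduct.tmul_mul_tmul, mul_one, one_mul, TensorProduct.sub_tmul,
      TensorProduct.tmul_sub, TensorProduct.zero_tmul, TensorProduct.tmul_zero]
    abel

theorem antipode_rho (a : Ass K n) : antipode K n (rho u a) = rho u (antipode K n a) := by
  induction a using left_induction with
  | one => simp [rho_one, antipode_one]
  | add a b ha hb => simp only [map_add, ha, hb]
  | smul c a ha => simp only [map_smul, ha]
  | gen_mul i a ih =>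
    have h : antipode K n (rho u (gen K n i)) = rho u (antipode K n (gen K n i)) := by
      rw [rho_gen', map_sub, antipode_mul, antipode_mul, antipode_lieToAss, antipode_gen, map_neg,
        rho_gen']
      noncomm_ring
    rw [rho_mul, map_add, antipode_mul, antipode_mul, antipode_mul, rho_mul, ih, h]
    abel

/-- The action of `u` on `tr_n ⊗ ass_n`. -/
def mixedAct : Tr K n ⊗[K] Ass K n →ₗ[K] Tr K n ⊗[K] Ass K n :=
  LinearMap.rTensor (Ass K n) (rhoTr u) + LinearMap.lTensor (Tr K n) (rho u)

theorem closeUp_tensorAct (t : Ass K n ⊗[K] Ass K n) :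
    closeUp K n (tensorAct (rho u) t) = mixedAct u (closeUp K n t) := by
  induction t with
  | zero => simp
  | add x y hx hy => simp only [map_add, hx, hy]
  | tmul a b =>
    simp only [tensorAct, LinearMap.add_apply, LinearMap.rTensor_tmul, LinearMap.lTensor_tmul,
      map_add, closeUp_tmul, coproduct_rho]
    induction coproduct K n b with
    | zero => simp
    | add x y hx hy =>
      simp only [map_add] at hx hy ⊢
      rw [← hx, ← hy]; abel
    | tmul p q =>
      simp only [closeAux, mixedAct, LinearMap.add_apply, LinearMap.rTensor_tmul,
        LinearMap.lTensor_tmul, LinearMap.comp_apply, LinearMap.mulLeft_apply,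
        map_add, antipode_rho, rhoTr_tr, rho_mul, TensorProduct.add_tmul]
      abel

theorem lTensor_tr_mixedAct (t : Tr K n ⊗[K] Ass K n) :
    LinearMap.lTensor (Tr K n) (tr K n) (mixedAct u t) =
      tensorAct (rhoTr u) (LinearMap.lTensor (Tr K n) (tr K n) t) := by
  induction t with
  | zero => simp
  | add x y hx hy => simp only [map_add, hx, hy]
  | tmul p q => simp [mixedAct, tensorAct, rhoTr_tr]

theorem alt_tensorAct {V : Type*} [AddCommGroup V] [Module K V] (D : V →ₗ[K] V) (t : V ⊗[K] V) :
    alt K V (tensorAct D t) = tensorAct D (alt K V t) := by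
  induction t with
  | zero => simp
  | add x y hx hy => simp only [map_add, hx, hy]
  | tmul p q => simp [alt, tensorAct]; abel

/-- The commutator of `ρ(u)` and `μ^f_gr`. -/
def muDefect : Ass K n →ₗ[K] Ass K n := rho u ∘ₗ muGr K n - muGr K n ∘ₗ rho u

/-- The map `a ↦ ∑ |a' ι(m(a'')')| ⊗ m(a'')''` for a linear endomorphism `m` of `ass_n`. -/
def closeDelta (m : Ass K n →ₗ[K] Ass K n) : Ass K n →ₗ[K] Tr K n ⊗[K] Ass K n :=
  closeUp K n ∘ₗ LinearMap.lTensor (Ass K n) m ∘ₗ (coproduct K n).toLinearMap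

/-- The commutator of `ρ(u)` and `δ^f_gr` in terms of that of `ρ(u)` and `μ^f_gr`. -/
theorem deltaGr_defect (a : Ass K n) :
    tensorAct (rhoTr u) (deltaGr K n (tr K n a)) - deltaGr K n (rhoTr u (tr K n a)) =
      alt K (Tr K n) (LinearMap.lTensor (Tr K n) (tr K n) (closeDelta (muDefect u) a)) := by
  rw [rhoTr_tr, deltaGr_tr, deltaGr_tr]
  simp only [deltaLift, murGr, closeDelta, LinearMap.comp_apply, AlgHom.toLinearMap_apply]
  -- The action is pulled inwards through `Alt`, the trace and the closing-up map, and out of `Δ`;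
  -- only its commutator with `id ⊗ μ` survives.
  rw [← alt_tensorAct, ← lTensor_tr_mixedAct, ← closeUp_tensorAct, coproduct_rho, ← map_sub,
    ← map_sub, ← map_sub]
  congr 3
  induction coproduct K n a with
  | zero => simp
  | add x y hx hy =>
    simp only [map_add] at hx hy ⊢
    rw [← hx, ← hy]; abel
  | tmul p q =>
    simp [tensorAct, muDefect]

end

/-! ### Cyclic coefficients on `tr_n` -/

section

/-- The functional summing the coefficients of all rotations of the word `v`. -/
def cycCoefAss (v : List (Fin n)) : Ass K n →ₗ[K] K :=
  ∑ k ∈ Finset.range v.length, coef (v.rotate k)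

theorem cycCoefAss_apply (v : List (Fin n)) (a : Ass K n) :
    cycCoefAss v a = ∑ k ∈ Finset.range v.length, coef (v.rotate k) a := by
  simp [cycCoefAss]

theorem sum_rotate_succ {M : Type*} [AddCommMonoid M] (v : List (Fin n)) (f : List (Fin n) → M) :
    ∑ k ∈ Finset.range v.length, f (v.rotate (k + 1)) =
      ∑ k ∈ Finset.range v.length, f (v.rotate k) := by
  cases h : v.length with
  | zero => simp
  | succ m =>
    rw [Finset.sum_range_succ, Finset.sum_range_succ', ← h, List.rotate_length, List.rotate_zero]

theorem cycCoefAss_mul_comm (v : List (Fin n)) (a b : Ass K n) :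
    cycCoefAss v (a * b) = cycCoefAss v (b * a) := by
  induction a using FreeAlgebra.induction generalizing b with
  | grade0 r => rw [Algebra.commutes]
  | grade1 i =>
    rw [cycCoefAss_apply, cycCoefAss_apply,
      ← sum_rotate_succ v fun l => coef l (b * FreeAlgebra.ι K i)]
    refine Finset.sum_congr rfl fun k _ => ?_
    rw [coef_gen_mul, List.rotate_rotate]
  | mul a c ha hc => rw [mul_assoc, ha, mul_assoc, hc, mul_assoc]
  | add a c ha hc => rw [add_mul, mul_add, map_add, map_add, ha, hc]

/-- The functional on `tr_n` induced by the sum of the coefficients of the rotations of `v`. -/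
def cycCoef (v : List (Fin n)) : Tr K n →ₗ[K] K :=
  (commutators K n).liftQ (cycCoefAss v) <| Submodule.span_le.2 <| by
    rintro _ ⟨a, b, rfl⟩
    simp [cycCoefAss_mul_comm v a b]

theorem cycCoef_tr (v : List (Fin n)) (a : Ass K n) :
    cycCoef v (tr K n a) = ∑ k ∈ Finset.range v.length, coef (v.rotate k) a := by
  rw [← cycCoefAss_apply]; rfl

theorem cycCoef_nil (t : Tr K n) : cycCoef [] t = 0 := by
  obtain ⟨a, rfl⟩ := (commutators K n).mkQ_surjective t
  exact (cycCoef_tr [] a).trans (by simp)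

/-- The augmentation of `tr_n`. -/
def augTr : Tr K n →ₗ[K] K :=
  (commutators K n).liftQ (coef []) <| Submodule.span_le.2 <| by
    rintro _ ⟨a, b, rfl⟩
    simp [coef_nil_mul, mul_comm]

theorem augTr_tr (a : Ass K n) : augTr (tr K n a) = coef [] a := rfl

theorem tr_word_rotate (l : List (Fin n)) (k : ℕ) :
    tr K n (word K n (l.rotate k)) = tr K n (word K n l) := by
  rw [List.rotate_eq_drop_append_take_mod, word_append, tr_mul_comm, ← word_append,
    List.take_append_drop]

/-- Rotation by `k` is undone by rotation by the length minus `k`. The index is shifted by one in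
the proof because reversing a range sends `k` to the length minus `k + 1`. -/
theorem sum_rotate_eq_comm {R : Type*} [AddCommMonoid R] (c : R) (l v : List (Fin n)) :
    ∑ k ∈ Finset.range l.length, (if l.rotate k = v then c else 0) =
      ∑ k ∈ Finset.range v.length, (if v.rotate k = l then c else 0) := by
  by_cases hlen : l.length = v.length
  · rw [← sum_rotate_succ v fun w => if w = l then c else 0, hlen,
      ← Finset.sum_range_reflect (fun k => if v.rotate (k + 1) = l then c else 0)]
    refine Finset.sum_congr rfl fun k hk => if_congr ?_ rfl rfl
    have hk := Finset.mem_range.1 hk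
    have e : v.length - 1 - k + 1 = v.length - k := by omega
    rw [e]
    constructor
    · rintro rfl
      rw [List.rotate_rotate, List.length_rotate, Nat.add_sub_cancel' (by simpa using hk.le),
        List.rotate_length]
    · rintro rfl
      rw [List.rotate_rotate, Nat.sub_add_cancel hk.le, List.rotate_length]
  · rw [Finset.sum_eq_zero, Finset.sum_eq_zero]
    · intro k _
      rw [if_neg]
      rintro rfl
      simp at hlen
    · intro k _
      rw [if_neg]
      rintro rfl
      simp at hlen

/-- Averaging over rotations; a section of `| |` in positive degree. -/
def cycAverage : Ass K n →ₗ[K] Ass K n :=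
  onWords K n fun l => (l.length : K)⁻¹ • ∑ k ∈ Finset.range l.length, word K n (l.rotate k)

theorem coef_cycAverage (v : List (Fin n)) (a : Ass K n) :
    coef v (cycAverage a) = (v.length : K)⁻¹ * cycCoef v (tr K n a) := by
  have : coef v ∘ₗ cycAverage = (v.length : K)⁻¹ • (cycCoef v ∘ₗ tr K n) := by
    refine ext_words K n fun l => ?_
    simp only [LinearMap.comp_apply, LinearMap.smul_apply, cycCoef_tr, cycAverage, onWords_word,
      map_smul, map_sum, coef_word, smul_eq_mul]
    rw [sum_rotate_eq_comm]
    by_cases h : v.length = l.length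
    · rw [h]
      simp only [eq_comm]
    · rw [Finset.sum_eq_zero, Finset.sum_eq_zero, mul_zero, mul_zero]
      · intro k _
        rw [if_neg]
        rintro rfl
        simp at h
      · intro k _
        rw [if_neg]
        rintro rfl
        simp at h
  exact LinearMap.congr_fun this a

theorem cycCoef_eq_zero_of_mem_trGE (v : List (Fin n)) (N : ℕ) (hv : v.length < N) (t : Tr K n)
    (ht : t ∈ trGE K n N) : cycCoef v t = 0 := by
  induction ht using Submodule.span_induction with
  | mem x hx =>
    obtain ⟨l, hl, rfl⟩ := hx
    rw [cycCoef_tr]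
    refine Finset.sum_eq_zero fun k _ => ?_
    rw [coef_word, if_neg]
    rintro rfl
    simp at hl
    omega
  | zero => simp
  | add x y _ _ hx hy => rw [map_add, hx, hy, add_zero]
  | smul c x _ hx => rw [map_smul, hx, smul_zero]

variable [CharZero K]

/-- All rotations of a word have the same trace, so averaging does not change it. Constants are
lost, since the empty word has an empty sum of rotations. -/
theorem tr_cycAverage (a : Ass K n) :
    tr K n (cycAverage a) = tr K n a - coef [] a • tr K n 1 := by
  have : tr K n ∘ₗ cycAverage = tr K n - (coef []).smulRight (tr K n 1) := by
    refine ext_words K n fun l => ?_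
    simp only [LinearMap.comp_apply, LinearMap.sub_apply, LinearMap.smulRight_apply, cycAverage,
      onWords_word, map_smul, map_sum, tr_word_rotate, Finset.sum_const, Finset.card_range,
      coef_word]
    cases l with
    | nil => simp [word_nil]
    | cons i l =>
      rw [← Nat.cast_smul_eq_nsmul K, smul_smul, inv_mul_cancel₀ (by simp; norm_cast)]
      simp
  exact LinearMap.congr_fun this a

/-- Without constant term, `t` is the trace of a cyclic average, whose coefficients are the cyclic
coefficients of `t` divided by the length. This is how `div(u)` is recovered from its cyclic
coefficients. -/
theorem mem_of_cycCoef (S : Submodule K (Tr K n)) (t : Tr K n) (h0 : augTr t = 0)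
    (h : ∀ v, cycCoef v t ≠ 0 → tr K n (word K n v) ∈ S) : t ∈ S := by
  obtain ⟨a, rfl⟩ := (commutators K n).mkQ_surjective t
  change augTr (tr K n a) = 0 at h0
  change ∀ v, cycCoef v (tr K n a) ≠ 0 → _ at h
  change tr K n a ∈ S
  have e := tr_cycAverage a
  rw [← augTr_tr, h0, zero_smul, sub_zero] at e
  rw [← e]
  refine mem_of_coef _ _ _ fun l hl => h l fun h1 => hl ?_
  rw [coef_cycAverage, h1, mul_zero]

end

/-! ### Special derivations -/

section

variable (u : TDer K n)

/-- The element `∑_i x_i u_i`, cyclically invariant when `u` is special. -/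
def potential : Ass K n := ∑ i, gen K n i * lieToAss K n (u i)

theorem mem_sder_iff :
    u ∈ sder K n ↔ potential u = ∑ i, lieToAss K n (u i) * gen K n i := by
  have : rho u (gen₀ K n) = potential u - ∑ i, lieToAss K n (u i) * gen K n i := by
    rw [gen₀, map_sum, potential, ← Finset.sum_sub_distrib]
    exact Finset.sum_congr rfl fun i _ => rho_gen' u i
  rw [sder, Set.mem_ofPred_eq, this, sub_eq_zero]

theorem coef_cons_potential (i : Fin n) (l : List (Fin n)) :
    coef (i :: l) (potential u) = coef l (lieToAss K n (u i)) :=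
  coef_cons_sum _ i l

/-- `ρ(u)` commutes with `η_gr`, in terms of the bilinear form. -/
def CommutesEta : Prop :=
  ∀ a b, rho u (etaBil K n a b) = etaBil K n (rho u a) b + etaBil K n a (rho u b)

theorem commutesEta_iff :
    CommutesEta u ↔ rho u ∘ₗ etaGr K n = etaGr K n ∘ₗ tensorAct (rho u) := by
  constructor
  · intro h
    refine TensorProduct.ext' fun a b => ?_
    simpa [etaGr, tensorAct] using h a b
  · intro h a b
    simpa [etaGr, tensorAct] using LinearMap.congr_fun h (a ⊗ₜ b)

variable {u}

/-- Moving the first letter to the end exchanges the expressions `∑ x_i u_i` and `∑ u_i x_i`, which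
agree for special `u`. -/
theorem coef_rotate_potential (hu : u ∈ sder K n) (l : List (Fin n)) (k : ℕ) :
    coef (l.rotate k) (potential u) = coef l (potential u) := by
  induction k with
  | zero => simp
  | succ k ih =>
    rw [← List.rotate_rotate, ← ih]
    cases l.rotate k with
    | nil => simp
    | cons i l =>
      rw [List.rotate_cons_succ, List.rotate_zero]
      conv_lhs => rw [(mem_sder_iff u).1 hu]
      rw [coef_snoc_sum, coef_cons_potential]

/-- Contract `∑ x_k u_k = ∑ u_k x_k` with `x_i` on the left and `x_j` on the right. Each order of
contraction isolates one `u_k`; the augmentation terms drop out because Lie elements have no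
constant term. -/
theorem etaBil_lieToAss_mul_gen (hu : u ∈ sder K n) (i j : Fin n) :
    etaBil K n (gen K n i) (lieToAss K n (u j)) * gen K n j =
      gen K n i * etaBil K n (lieToAss K n (u i)) (gen K n j) := by
  have h := etaBil_gen_etaBil i j (potential u)
  conv_lhs at h => rw [(mem_sder_iff u).1 hu, etaBil_sum_mul_gen]
  rw [potential, etaBil_sum_gen_mul, map_neg, map_neg, LinearMap.neg_apply, neg_inj,
    etaBil_mul_right, etaBil_mul_left, coef_nil_lieToAss, coef_nil_lieToAss] at h
  simpa using h

/-- The product rules for `η`, the Leibniz rule and `ε ∘ ρ(u) = 0` reduce the claim to a pair of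
generators, where it is `etaBil_lieToAss_mul_gen`. -/
theorem commutesEta_of_mem_sder (hu : u ∈ sder K n) : CommutesEta u := by
  intro a b
  induction a using left_induction with
  | one => simp [etaBil_one_left, rho_one]
  | add x y hx hy => simp only [map_add, LinearMap.add_apply, hx, hy]; abel
  | smul r x hx => simp only [map_smul, LinearMap.smul_apply, hx, smul_add]
  | gen_mul i a iha =>
    have hg : rho u (etaBil K n (gen K n i) b) =
        etaBil K n (rho u (gen K n i)) b + etaBil K n (gen K n i) (rho u b) := by
      clear iha
      induction b using left_induction with
      | one => simp [etaBil_one_right, rho_one]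
      | add x y hx hy => simp only [map_add, hx, hy]; abel
      | smul r x hx => simp only [map_smul, hx, smul_add]
      | gen_mul j b ihb =>
        have hgg : rho u (etaBil K n (gen K n i) (gen K n j)) =
            etaBil K n (rho u (gen K n i)) (gen K n j) +
              etaBil K n (gen K n i) (rho u (gen K n j)) := by
          rw [etaBil_gen_gen, rho_gen', rho_gen', map_sub, map_sub, LinearMap.sub_apply,
            etaBil_mul_left, etaBil_mul_left, etaBil_mul_right, etaBil_mul_right,
            coef_nil_lieToAss, coef_nil_lieToAss, coef_nil_gen, coef_nil_gen, etaBil_gen_gen,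
            etaBil_lieToAss_mul_gen hu]
          split_ifs with h
          · subst h
            simp only [map_neg, rho_gen', zero_smul]
            noncomm_ring
          · simp
        simp only [etaBil_mul_right, rho_mul, map_add, coef_nil_gen, coef_nil_rho, zero_smul,
          add_zero, hgg]
        noncomm_ring
    rw [etaBil_mul_left, map_add, map_smul, rho_mul, rho_mul, map_add, LinearMap.add_apply,
      etaBil_mul_left, etaBil_mul_left, etaBil_mul_left, coef_nil_rho, iha, hg]
    simp only [zero_smul, add_zero, mul_add, smul_add]
    abel

theorem mem_sder_of_commutesEta (h : CommutesEta u) : u ∈ sder K n := by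
  have h0 := h (gen₀ K n) (gen₀ K n)
  rw [etaBil_gen₀_left, etaBil_gen₀_left, etaBil_gen₀_right, coef_nil_gen₀, coef_nil_rho] at h0
  simp only [zero_smul, sub_zero, map_neg] at h0
  -- At `(x_0, x_0)` the relation reads `-ρ(u)(x_0) = -2 ρ(u)(x_0)`; adding `2 ρ(u)(x_0)` isolates
  -- `ρ(u)(x_0)` without division.
  have h1 := congrArg (· + (rho u (gen₀ K n) + rho u (gen₀ K n))) h0
  rw [sder, Set.mem_ofPred_eq]
  simpa using h1

theorem mem_sder_iff_commutesEta : u ∈ sder K n ↔ CommutesEta u :=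
  ⟨commutesEta_of_mem_sder, mem_sder_of_commutesEta⟩

/-! ### The commutator of `ρ(u)` with `μ`, and its relation to the divergence. -/

variable (u) in
/-- The element `∂_i u_i - μ^f_gr(u_i)`. -/
def muResidue (i : Fin n) : Ass K n :=
  partialD K n i (lieToAss K n (u i)) - muGr K n (lieToAss K n (u i))

/-- `μ` fails the Leibniz rule exactly by `η`, and `η` cancels from the commutator because `ρ(u)`
commutes with it. -/
theorem muDefect_mul (hu : CommutesEta u) (a b : Ass K n) :
    muDefect u (a * b) = muDefect u a * b + a * muDefect u b := by
  simp only [muDefect, LinearMap.sub_apply, LinearMap.comp_apply, rho_mul, muGr_mul, map_add,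
    hu a b]
  noncomm_ring

theorem muDefect_one : muDefect u 1 = 0 := by
  simp [muDefect, muGr_one, rho_one]

theorem muGr_gen (i : Fin n) : muGr K n (gen K n i) = 0 := by
  rw [← word_single, muGr, onWords_word, muWord]

theorem muDefect_gen (hu : u ∈ sder K n) (i : Fin n) :
    muDefect u (gen K n i) = gen K n i * muResidue u i - muResidue u i * gen K n i := by
  have h : etaBil K n (gen K n i) (lieToAss K n (u i)) =
      -(gen K n i * partialD K n i (lieToAss K n (u i))) := by
    have := etaBil_lieToAss_mul_gen hu i i
    rw [etaBil_gen_right, mul_neg, ← mul_assoc, ← neg_mul] at this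
    exact mul_right_cancel₀ (FreeAlgebra.ι_ne_zero i) this
  rw [muDefect, LinearMap.sub_apply, LinearMap.comp_apply, LinearMap.comp_apply, muGr_gen,
    map_zero, rho_gen', map_sub, muGr_mul, muGr_mul, muGr_gen, h, etaBil_gen_right, muResidue]
  noncomm_ring

theorem muDefect_gen_pow (hu : u ∈ sder K n) (i : Fin n) (m : ℕ) :
    muDefect u (gen K n i ^ m) = gen K n i ^ m * muResidue u i - muResidue u i * gen K n i ^ m := by
  induction m with
  | zero => simp [muDefect_one]
  | succ m ih =>
    rw [pow_succ, muDefect_mul (commutesEta_of_mem_sder hu), ih, muDefect_gen hu]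
    noncomm_ring

/-- The cyclic coefficients of the divergence of a special derivation. -/
theorem cycCoef_divergence (hu : u ∈ sder K n) (i : Fin n) (w : List (Fin n)) :
    cycCoef (i :: w) (divergence u) = coef w (muResidue u i) := by
  have hdiv : divergence u =
      tr K n (∑ i, gen K n i * partialD K n i (lieToAss K n (u i))) := by
    rw [map_sum, divergence]
  -- The trivial rotation of `x_i w` gives the coefficient of `w` in `∂_i u_i`. The remaining
  -- rotations, one for each letter of `w`, must match the letter doublings in `-μ(u_i)`.
  rw [hdiv, cycCoef_tr, List.length_cons, Finset.sum_range_succ', List.rotate_zero, coef_cons_sum,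
    muResidue, map_sub, coef_muGr, sub_neg_eq_add, add_comm, Finset.sum_range]
  congr 1
  refine Finset.sum_congr rfl fun k _ => ?_
  have hk : w.drop k = w[k] :: w.drop (k + 1) := (List.getElem_cons_drop k.2).symm
  have hrot : (i :: w).rotate (k + 1) = w[k] :: (w.drop (k + 1) ++ i :: w.take k) := by
    rw [List.rotate_cons_succ, List.rotate_eq_drop_append_take (by simp; omega),
      List.drop_append_of_le_length k.2.le, List.take_append_of_le_length k.2.le, hk]
    simp only [List.cons_append, List.append_assoc, List.nil_append]
  rw [hrot, coef_cons_sum, coef_partialD, ← coef_cons_potential, ← coef_cons_potential]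
  -- The rotation starting at `w[k]` acquires a second `w[k]` at its end from `∂`. Cyclically this
  -- is `x_i` followed by `w` with `w[k]` doubled, so the cyclic invariance of `potential u`
  -- applies.
  have e1 : w[k] :: (w.drop (k + 1) ++ i :: w.take k ++ [w[k]]) =
      w.drop k ++ (i :: w.take k ++ [w[k]]) := by
    rw [hk]; simp only [List.cons_append, List.append_assoc]
  have e2 : i :: (w.take k ++ w[k] :: w.drop k) = (i :: w.take k ++ [w[k]]) ++ w.drop k := by
    simp only [List.cons_append, List.append_assoc, List.nil_append]
  rw [e1, e2, ← List.rotate_append_length_eq, coef_rotate_potential hu]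

/-- Both terms of the residue only see the coefficient of `x_i^(s+1)` in the Lie element `u_i`,
which vanishes as `s + 1 ≥ 2`. -/
theorem coef_replicate_muResidue (i : Fin n) (s : ℕ) (hs : 1 ≤ s) :
    coef (List.replicate s i) (muResidue u i) = 0 := by
  have h : coef (List.replicate (s + 1) i) (lieToAss K n (u i)) = 0 :=
    coef_replicate_lieToAss _ i _ (by omega)
  rw [muResidue, map_sub, coef_partialD, ← List.replicate_succ', h, coef_muGr,
    Finset.sum_eq_zero, neg_zero, sub_zero]
  intro k _
  have hk : (k : ℕ) < s := by simpa using k.2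
  have e : (List.replicate s i).take k ++ (List.replicate s i)[k] :: (List.replicate s i).drop k =
      List.replicate (s + 1) i := by
    rw [List.eq_replicate_iff]
    constructor
    · simp; omega
    · intro b hb
      simp only [List.mem_append, List.mem_cons] at hb
      rcases hb with hb | hb | hb
      · exact List.eq_of_mem_replicate (List.mem_of_mem_take hb)
      · rw [hb]; simp
      · exact List.eq_of_mem_replicate (List.mem_of_mem_drop hb)
  rw [e, h]

theorem augTr_divergence : augTr (divergence u) = 0 := by
  rw [divergence, map_sum]
  exact Finset.sum_eq_zero fun i _ => by rw [augTr_tr, coef_nil_gen_mul]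

end

/-! ### The Kashiwara–Vergne Lie algebras in terms of coefficients -/

section

theorem coef_aeval_gen₀ (p : Polynomial K) (l : List (Fin n)) :
    coef l (Polynomial.aeval (gen₀ K n) p) = p.coeff l.length := by
  induction p using Polynomial.induction_on' with
  | add p q hp hq => simp [hp, hq]
  | monomial m c =>
    rw [Polynomial.aeval_monomial, ← Algebra.smul_def, map_smul, coef_gen₀_pow,
      Polynomial.coeff_monomial]
    simp [eq_comm]

theorem coef_aeval_gen (p : Polynomial K) (i : Fin n) (l : List (Fin n)) :
    coef l (Polynomial.aeval (gen K n i) p) =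
      if l = List.replicate l.length i then p.coeff l.length else 0 := by
  induction p using Polynomial.induction_on' with
  | add p q hp hq => rw [map_add, map_add, hp, hq]; split_ifs <;> simp
  | monomial m c =>
    rw [Polynomial.aeval_monomial, ← Algebra.smul_def, map_smul, coef_gen_pow,
      Polynomial.coeff_monomial]
    by_cases hm : m = l.length
    · subst hm; simp
    · rw [if_neg, if_neg hm]
      · simp
      · rintro rfl; simp at hm

theorem rotate_eq_replicate_iff (l : List (Fin n)) (k : ℕ) (j : Fin n) :
    l.rotate k = List.replicate (l.rotate k).length j ↔ l = List.replicate l.length j := by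
  rw [List.rotate_eq_iff, List.rotate_replicate, List.length_rotate]

theorem cycCoef_aeval (f₀ : Polynomial K) (f : Fin n → Polynomial K) (i : Fin n)
    (w : List (Fin n)) :
    cycCoef (i :: w) (tr K n (Polynomial.aeval (gen₀ K n) f₀) +
      ∑ j, tr K n (Polynomial.aeval (gen K n j) (f j))) =
      (w.length + 1 : K) * (f₀.coeff (w.length + 1) +
        if w = List.replicate w.length i then (f i).coeff (w.length + 1) else 0) := by
  have h : ∀ j, (i :: w = List.replicate (w.length + 1) j) ↔
      (j = i ∧ w = List.replicate w.length i) := by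
    intro j
    rw [List.replicate_succ, List.cons.injEq]
    constructor
    · rintro ⟨rfl, h⟩; exact ⟨rfl, h⟩
    · rintro ⟨rfl, h⟩; exact ⟨rfl, h⟩
  rw [map_add, map_sum, mul_add]
  simp only [cycCoef_tr, coef_aeval_gen₀, coef_aeval_gen, rotate_eq_replicate_iff]
  simp only [List.length_rotate, List.length_cons, h, Finset.sum_const, Finset.card_range,
    nsmul_eq_mul, ite_and, Finset.sum_ite_eq', Finset.mem_univ, mul_ite, mul_zero, if_true,
    Nat.cast_add, Nat.cast_one]

variable [CharZero K] (u : TDer K n)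

theorem mem_krv₀_iff :
    u ∈ krv₀ K n ↔ u ∈ sder K n ∧ ∀ i, ∀ w : List (Fin n), w ≠ [] → coef w (muResidue u i) = 0 := by
  rw [krv₀, Set.mem_ofPred_eq]
  refine and_congr_right fun hu => ⟨fun h i w hw => ?_, fun h => ?_⟩
  · rw [← cycCoef_divergence hu]
    generalize divergence u = t at h ⊢
    induction h using Submodule.span_induction with
    | mem x hx =>
      obtain ⟨j, rfl⟩ := hx
      simp only [cycCoef_tr]
      refine Finset.sum_eq_zero fun k _ => ?_
      rw [← word_single, coef_word, if_neg]
      intro h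
      have h1 := congrArg List.length h
      rw [List.length_rotate] at h1
      simp only [List.length_cons, List.length_nil] at h1
      exact hw (List.length_eq_zero_iff.1 (by omega))
    | zero => simp
    | add x y _ _ hx hy => rw [map_add, hx, hy, add_zero]
    | smul c x _ hx => rw [map_smul, hx, smul_zero]
  · refine mem_of_cycCoef _ _ augTr_divergence fun v hv => ?_
    cases v with
    | nil => exact absurd (cycCoef_nil _) hv
    | cons i w =>
      rw [cycCoef_divergence hu] at hv
      have hw : w = [] := by
        by_contra hne
        exact hv (h i w hne)
      rw [hw, word_single]
      exact Submodule.subset_span ⟨i, rfl⟩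

/-- A power of `x_0` has the same coefficient at all words of its length, whereas a power of `x_i`
only affects the cyclic word that is that power. So `f_0` supplies `β`, and the `f_i` absorb
whatever happens at pure powers. -/
theorem mem_krv_iff :
    u ∈ krv K n ↔ u ∈ sder K n ∧ ∃ β : ℕ → K, ∀ i, ∀ w : List (Fin n),
      w ≠ List.replicate w.length i → coef w (muResidue u i) = β w.length := by
  rw [krv, Set.mem_ofPred_eq]
  refine and_congr_right fun hu => ⟨?_, ?_⟩
  · rintro ⟨f₀, f, h⟩
    refine ⟨fun m => (m + 1 : K) * PowerSeries.coeff (m + 1) f₀, fun i w hw => ?_⟩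
    -- The cyclic word `x_i w` has degree `w.length + 1`, so truncation at `w.length + 2` is the
    -- first to retain it.
    have h1 := cycCoef_eq_zero_of_mem_trGE (i :: w) (w.length + 2) (by simp) _ (h (w.length + 2))
    rw [map_sub, cycCoef_divergence hu, cycCoef_aeval, if_neg hw, add_zero, sub_eq_zero,
      PowerSeries.coeff_trunc, if_pos (by omega)] at h1
    exact h1
  · rintro ⟨β, h⟩
    -- Dividing by `k` compensates for the `k` rotations of a word of length `k`. At `k = 0`
    -- division by zero gives `0`, so no series has a constant term, as the augmentation of `div(u)`
    -- requires.
    refine ⟨PowerSeries.mk fun k => β (k - 1) / k, fun i => PowerSeries.mk fun k =>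
      (coef (List.replicate (k - 1) i) (muResidue u i) - β (k - 1)) / k, fun N => ?_⟩
    refine mem_of_cycCoef _ _ ?_ fun v hv => ?_
    · rw [map_sub, augTr_divergence, map_add, map_sum]
      simp only [augTr_tr, coef_aeval_gen₀, coef_aeval_gen, PowerSeries.coeff_trunc,
        PowerSeries.coeff_mk]
      simp
    · refine Submodule.subset_span ⟨v, ?_, rfl⟩
      by_contra hlt
      refine hv ?_
      cases v with
      | nil => exact cycCoef_nil _
      | cons i w =>
        have hN : w.length + 1 < N := by simpa using hlt
        have h0 : (w.length + 1 : K) ≠ 0 := by norm_cast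
        rw [map_sub, cycCoef_divergence hu, cycCoef_aeval, PowerSeries.coeff_trunc, if_pos hN,
          PowerSeries.coeff_trunc, if_pos hN, PowerSeries.coeff_mk, PowerSeries.coeff_mk,
          Nat.add_sub_cancel, Nat.cast_add, Nat.cast_one]
        by_cases hw : w = List.replicate w.length i
        · rw [if_pos hw, ← hw]
          field_simp
          ring
        · rw [if_neg hw, h i w hw]
          field_simp
          ring

end

/-! ### Commutation with `μ^f_gr` -/

section

variable {u : TDer K n}

/-- A map satisfying the Leibniz rule is determined by its values on generators. -/
theorem leibniz_ext {d e : Ass K n →ₗ[K] Ass K n} (hd : ∀ a b, d (a * b) = d a * b + a * d b)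
    (he : ∀ a b, e (a * b) = e a * b + a * e b) (h : ∀ i, d (gen K n i) = e (gen K n i)) :
    d = e := by
  ext a
  induction a using left_induction with
  | one =>
    have h1 := hd 1 1
    have h2 := he 1 1
    simp only [mul_one, one_mul, left_eq_add] at h1 h2
    rw [h1, h2]
  | add x y hx hy => rw [map_add, map_add, hx, hy]
  | smul r x hx => rw [map_smul, map_smul, hx]
  | gen_mul i a ih => rw [hd, he, h, ih]

/-- The derivation vanishes iff each `r_i` centralizes `x_i`. This leaves only powers of `x_i`, and
`coef_replicate_muResidue` excludes the non-constant ones. -/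
theorem muDefect_eq_zero_iff (hu : u ∈ sder K n) :
    muDefect u = 0 ↔ ∀ i, ∀ w : List (Fin n), w ≠ [] → coef w (muResidue u i) = 0 := by
  have h1 : muDefect u = 0 ↔ ∀ i, gen K n i * muResidue u i = muResidue u i * gen K n i := by
    constructor
    · intro h i
      rw [← sub_eq_zero, ← muDefect_gen hu, h, LinearMap.zero_apply]
    · intro h
      refine leibniz_ext (muDefect_mul (commutesEta_of_mem_sder hu)) (by simp) fun i => ?_
      rw [muDefect_gen hu, h, sub_self, LinearMap.zero_apply]
  rw [h1]
  refine forall_congr' fun i => ?_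
  rw [commute_gen_iff]
  constructor
  · intro h w hw
    by_cases hr : w = List.replicate w.length i
    · rw [hr]
      exact coef_replicate_muResidue i _ (List.length_pos_iff.2 hw)
    · exact h w hr
  · intro h w hw
    refine h w ?_
    rintro rfl
    exact hw rfl

end

/-! ### Commutation with `δ^f_gr`: sufficiency -/

section

/-- For a generator, the two terms of `Δ(x_i)` contribute opposite traces by `closeUp_left`, and
only multiplication on the second factor remains. -/
theorem closeUp_coproduct_mul (a : Ass K n) (t : Ass K n ⊗[K] Ass K n) :
    closeUp K n (coproduct K n a * t) =
      LinearMap.lTensor (Tr K n) (LinearMap.mulLeft K a) (closeUp K n t) := by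
  induction a using left_induction generalizing t with
  | one => simp
  | add x y hx hy =>
    rw [map_add, add_mul, map_add, hx, hy, ← LinearMap.add_apply, ← LinearMap.lTensor_add]
    congr 2
    ext z; simp [add_mul]
  | smul r x hx =>
    rw [map_smul, smul_mul_assoc, map_smul, hx, ← LinearMap.smul_apply, ← LinearMap.lTensor_smul]
    congr 2
    ext z; simp
  | gen_mul i a ih =>
    rw [map_mul (coproduct K n), coproduct_gen, mul_assoc, add_mul, map_add, closeUp_left,
      add_neg_cancel_left, ih,
      lmul, ← LinearMap.comp_apply, ← LinearMap.lTensor_comp]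
    congr 2
    ext z; simp

theorem closeUp_mul_coproduct (a : Ass K n) (t : Ass K n ⊗[K] Ass K n) :
    closeUp K n (t * coproduct K n a) =
      LinearMap.lTensor (Tr K n) (LinearMap.mulRight K a) (closeUp K n t) := by
  induction a using right_induction generalizing t with
  | one => simp
  | add x y hx hy =>
    rw [map_add, mul_add, map_add, hx, hy, ← LinearMap.add_apply, ← LinearMap.lTensor_add]
    congr 2
    ext z; simp [mul_add]
  | smul r x hx =>
    rw [map_smul, mul_smul_comm, map_smul, hx, ← LinearMap.smul_apply, ← LinearMap.lTensor_smul]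
    congr 2
    ext z; simp
  | mul_gen a i ih =>
    rw [map_mul (coproduct K n), coproduct_gen, ← mul_assoc, mul_add, map_add, closeUp_right,
      add_neg_cancel_left, ih, rmul, ← LinearMap.comp_apply, ← LinearMap.lTensor_comp]
    congr 2
    ext z; simp [mul_assoc]

/-- Here `id ⊗ [·, b]` sends `Δ(a)` to `Δ(a)(1 ⊗ b) - (1 ⊗ b)Δ(a)`. Closing up turns this into left
minus right multiplication by `a` on the second factor, which the trace kills. -/
theorem lTensor_tr_closeDelta_inner (b a : Ass K n) :
    LinearMap.lTensor (Tr K n) (tr K n)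
      (closeDelta (LinearMap.mulRight K b - LinearMap.mulLeft K b) a) = 0 := by
  have h : ∀ t : Ass K n ⊗[K] Ass K n,
      LinearMap.lTensor (Ass K n) (LinearMap.mulRight K b - LinearMap.mulLeft K b) t =
        t * (1 ⊗ₜ b) - (1 ⊗ₜ b) * t := by
    intro t
    induction t with
    | zero => simp
    | add x y hx hy => rw [map_add, hx, hy, add_mul, mul_add]; abel
    | tmul p q => simp
  simp only [closeDelta, LinearMap.comp_apply, AlgHom.toLinearMap_apply, h, map_sub,
    closeUp_coproduct_mul, closeUp_mul_coproduct]
  rw [sub_eq_zero]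
  induction closeUp K n (1 ⊗ₜ b) with
  | zero => simp
  | add x y hx hy => simp only [map_add, hx, hy]
  | tmul p q => simp [tr_mul_comm K n a]

variable {u : TDer K n}

theorem exists_muDefect_eq_inner (hu : u ∈ sder K n) (β : ℕ → K)
    (h : ∀ i, ∀ w : List (Fin n), w ≠ List.replicate w.length i →
      coef w (muResidue u i) = β w.length) :
    ∃ b : Ass K n, muDefect u = LinearMap.mulRight K b - LinearMap.mulLeft K b := by
  choose d hd using fun i => exists_length_bound (muResidue u i)
  let N := ∑ i, d i
  have hN : ∀ i, d i ≤ N := fun i => Finset.single_le_sum (fun _ _ => Nat.zero_le _)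
    (Finset.mem_univ i)
  -- The power `x_0^m` has coefficient `1` at every word of length `m`. Since `β` is unconstrained
  -- where no word tests it, the sum is cut at `N`, from which length on all residues vanish. Then
  -- `r_i - b` lies in `K[x_i]`.
  let b : Ass K n := ∑ m ∈ Finset.range N, β m • gen₀ K n ^ m
  have hb : ∀ l : List (Fin n), coef l b = if l.length < N then β l.length else 0 := by
    intro l
    simp [b, map_sum, coef_gen₀_pow]
  refine ⟨b, leibniz_ext (muDefect_mul (commutesEta_of_mem_sder hu)) ?_ fun i => ?_⟩
  · intro x y
    simp only [LinearMap.sub_apply, LinearMap.mulLeft_apply, LinearMap.mulRight_apply]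
    noncomm_ring
  · have hc : gen K n i * (muResidue u i - b) = (muResidue u i - b) * gen K n i := by
      refine (commute_gen_iff i _).2 fun l hl => ?_
      rw [map_sub, hb]
      split_ifs with hlt
      · rw [h i l hl, sub_self]
      · rw [hd i l ((hN i).trans (not_lt.1 hlt)), sub_zero]
    rw [muDefect_gen hu, LinearMap.sub_apply, LinearMap.mulLeft_apply, LinearMap.mulRight_apply]
    rw [mul_sub, sub_mul, sub_eq_sub_iff_add_eq_add] at hc
    rw [sub_eq_sub_iff_add_eq_add, hc, add_comm]

end

/-! ### Commutation with `δ^f_gr`: necessity -/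

section

/-- The hypotheses characterize the counit. They are stated for a general `φ` so as to cover both
`ε` and `ε ∘ ι`. -/
theorem counit_coproduct (φ : Ass K n →ₗ[K] K) (h1 : φ 1 = 1) (h : ∀ i a, φ (gen K n i * a) = 0)
    (a : Ass K n) :
    TensorProduct.lid K (Ass K n) (LinearMap.rTensor (Ass K n) φ (coproduct K n a)) = a := by
  induction a using left_induction with
  | one => simp [Algebra.TensorProduct.one_def, h1]
  | add x y hx hy => rw [map_add, map_add, map_add, hx, hy]
  | smul r x hx => rw [map_smul, map_smul, map_smul, hx]
  | gen_mul i a ih =>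
    have key : ∀ t : Ass K n ⊗[K] Ass K n, TensorProduct.lid K (Ass K n)
        (LinearMap.rTensor (Ass K n) φ ((gen K n i ⊗ₜ 1 + 1 ⊗ₜ gen K n i) * t)) =
          gen K n i * TensorProduct.lid K (Ass K n) (LinearMap.rTensor (Ass K n) φ t) := by
      intro t
      induction t with
      | zero => simp
      | add x y hx hy => rw [mul_add, map_add, map_add, hx, hy, map_add, map_add, mul_add]
      | tmul p q => simp [add_mul, h]
    rw [map_mul, coproduct_gen, key, ih]

/-- The map `p ⊗ q ↦ ε(p) q`. -/
def augLeft : Tr K n ⊗[K] Ass K n →ₗ[K] Ass K n :=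
  (TensorProduct.lid K (Ass K n)).toLinearMap ∘ₗ LinearMap.rTensor (Ass K n) augTr

/-- The map `p ⊗ q ↦ ε(q) p`. -/
def augRight : Tr K n ⊗[K] Ass K n →ₗ[K] Tr K n :=
  (TensorProduct.rid K (Tr K n)).toLinearMap ∘ₗ LinearMap.lTensor (Tr K n) (coef [])

theorem augLeft_tmul (p : Tr K n) (q : Ass K n) : augLeft (p ⊗ₜ q) = augTr p • q := by
  simp [augLeft]

theorem augRight_tmul (p : Tr K n) (q : Ass K n) : augRight (p ⊗ₜ q) = coef [] q • p := by
  simp [augRight]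

theorem augLeft_closeUp (p q : Ass K n) : augLeft (closeUp K n (p ⊗ₜ q)) = coef [] p • q := by
  have h := counit_coproduct (coef [] ∘ₗ antipode K n) (by simp [antipode_one, coef_one])
    (fun i a => by simp [antipode_mul, antipode_gen, coef_nil_mul_gen]) q
  conv_rhs => rw [← h]
  rw [closeUp_tmul]
  induction coproduct K n q with
  | zero => simp
  | add x y hx hy => simp only [map_add, hx, hy, smul_add]
  | tmul x y =>
    simp [closeAux, augLeft_tmul, augTr_tr, coef_nil_mul, smul_smul]

theorem augLeft_closeDelta (m : Ass K n →ₗ[K] Ass K n) (a : Ass K n) :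
    augLeft (closeDelta m a) = m a := by
  have h := counit_coproduct (coef []) (by simp [coef_one]) (fun i a => coef_nil_gen_mul i a) a
  conv_rhs => rw [← h]
  simp only [closeDelta, LinearMap.comp_apply, AlgHom.toLinearMap_apply]
  induction coproduct K n a with
  | zero => simp
  | add x y hx hy => simp only [map_add, hx, hy]
  | tmul x y => simp [augLeft_closeUp]

theorem augLeft_alt (t : Tr K n ⊗[K] Ass K n) :
    TensorProduct.lid K (Tr K n) (LinearMap.rTensor (Tr K n) augTr
      (alt K (Tr K n) (LinearMap.lTensor (Tr K n) (tr K n) t))) =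
        tr K n (augLeft t) - augRight t := by
  induction t with
  | zero => simp
  | add x y hx hy => simp only [map_add, hx, hy]; abel
  | tmul p q => simp [alt, augLeft_tmul, augRight_tmul, augTr_tr]

theorem augRight_lTensor_mulLeft (a : Ass K n) (t : Tr K n ⊗[K] Ass K n) :
    augRight (LinearMap.lTensor (Tr K n) (LinearMap.mulLeft K a) t) = coef [] a • augRight t := by
  induction t with
  | zero => simp
  | add x y hx hy => simp only [map_add, hx, hy, smul_add]
  | tmul p q => simp [augRight_tmul, coef_nil_mul, smul_smul]

theorem augRight_lTensor_mulRight (a : Ass K n) (t : Tr K n ⊗[K] Ass K n) :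
    augRight (LinearMap.lTensor (Tr K n) (LinearMap.mulRight K a) t) =
      coef [] a • augRight t := by
  induction t with
  | zero => simp
  | add x y hx hy => simp only [map_add, hx, hy, smul_add]
  | tmul p q => simp [augRight_tmul, coef_nil_mul, smul_smul, mul_comm]

/-- The composite sends `1 ⊗ q` to `|ι(q)|`, and `ι` preserves commutators up to sign. In the
computation the terms in `x_i ⊗ q` cancel and the others carry `ε(x_i) = 0`. -/
theorem augRight_closeUp_commutator (i : Fin n) (q : Ass K n) :
    augRight (closeUp K n (1 ⊗ₜ (gen K n i * q - q * gen K n i))) = 0 := by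
  have h1 := closeUp_left K n i (1 ⊗ₜ q)
  have h2 := closeUp_right K n i (1 ⊗ₜ q)
  simp only [Algebra.TensorProduct.tmul_mul_tmul, one_mul, mul_one] at h1 h2
  rw [TensorProduct.tmul_sub, map_sub, h1, h2, map_sub, map_add, map_add, lmul, rmul,
    augRight_lTensor_mulLeft, augRight_lTensor_mulRight, sub_self]

variable {u : TDer K n}

/-- Expanding the derivation along a first letter `x_i`, one term carries the factor `ε(x_i) = 0`
and the other involves `D(x_i) = [x_i, r_i]`, a commutator. -/
theorem augRight_closeDelta_muDefect (hu : u ∈ sder K n) (a : Ass K n) :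
    augRight (closeDelta (muDefect u) a) = 0 := by
  induction a using left_induction with
  | one => simp [closeDelta, Algebra.TensorProduct.one_def, muDefect_one]
  | add x y hx hy => rw [map_add, map_add, hx, hy, add_zero]
  | smul r x hx => rw [map_smul, map_smul, hx, smul_zero]
  | gen_mul i a ih =>
    have h : ∀ t : Ass K n ⊗[K] Ass K n,
        LinearMap.lTensor (Ass K n) (muDefect u) (coproduct K n (gen K n i) * t) =
          coproduct K n (gen K n i) * LinearMap.lTensor (Ass K n) (muDefect u) t +
            (1 ⊗ₜ muDefect u (gen K n i)) * t := by
      intro t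
      induction t with
      | zero => simp
      | add x y hx hy => simp only [mul_add, map_add, hx, hy]; abel
      | tmul p q =>
        simp only [coproduct_gen, add_mul, Algebra.TensorProduct.tmul_mul_tmul, map_add,
          LinearMap.lTensor_tmul, one_mul, muDefect_mul (commutesEta_of_mem_sder hu),
          TensorProduct.tmul_add]
        abel
    simp only [closeDelta, LinearMap.comp_apply, AlgHom.toLinearMap_apply, map_mul, h, map_add,
      closeUp_coproduct_mul, closeUp_mul_coproduct, augRight_lTensor_mulLeft,
      augRight_lTensor_mulRight, coef_nil_gen, zero_smul, zero_add]
    rw [muDefect_gen hu, augRight_closeUp_commutator, smul_zero]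

/-- Apply `ε ⊗ id` to the failure of `δ` to commute. By `augLeft_alt` the alternation yields
`|D(a)|` minus a right augmentation, and the latter vanishes. -/
theorem tr_muDefect_eq_zero (hu : u ∈ sder K n)
    (h : tensorAct (rhoTr u) ∘ₗ deltaGr K n = deltaGr K n ∘ₗ rhoTr u) (a : Ass K n) :
    tr K n (muDefect u a) = 0 := by
  have h1 := deltaGr_defect u a
  have h2 := LinearMap.congr_fun h (tr K n a)
  rw [LinearMap.comp_apply, LinearMap.comp_apply] at h2
  rw [h2, sub_self] at h1
  have h3 := augLeft_alt (closeDelta (muDefect u) a)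
  rw [← h1, map_zero, map_zero, augLeft_closeDelta, augRight_closeDelta_muDefect hu,
    sub_zero] at h3
  exact h3.symm

/-- This is `|D(x_i^N x_j^N)| = 0`, expanded and rearranged cyclically. -/
theorem tr_sandwich (hu : u ∈ sder K n) (h : ∀ a, tr K n (muDefect u a) = 0) (i j : Fin n)
    (N : ℕ) :
    tr K n (gen K n j ^ N * (muResidue u j - muResidue u i) * gen K n i ^ N) =
      tr K n (gen K n i ^ N * (muResidue u j - muResidue u i) * gen K n j ^ N) := by
  have h1 := h (gen K n i ^ N * gen K n j ^ N)
  rw [muDefect_mul (commutesEta_of_mem_sder hu), muDefect_gen_pow hu, muDefect_gen_pow hu] at h1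
  have e : ∀ q : Ass K n, tr K n (gen K n j ^ N * q * gen K n i ^ N) =
      tr K n (gen K n i ^ N * (gen K n j ^ N * q)) := fun q => tr_mul_comm K n _ _
  have e' : tr K n (muResidue u i * gen K n i ^ N * gen K n j ^ N) =
      tr K n (gen K n i ^ N * (gen K n j ^ N * muResidue u i)) := by
    rw [mul_assoc, tr_mul_comm, mul_assoc]
  rw [e]
  simp only [mul_sub, sub_mul, map_add, map_sub, e', ← mul_assoc] at h1 ⊢
  rw [← sub_eq_zero, ← h1]
  abel

end

/-! ### Words with long blocks of equal letters -/

section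

theorem coef_sandwich (i j : Fin n) (N M : ℕ) (s : List (Fin n)) (a : Ass K n) :
    coef (List.replicate N i ++ s ++ List.replicate M j) (gen K n i ^ N * a * gen K n j ^ M) =
      coef s a := by
  have : coef (List.replicate N i ++ s ++ List.replicate M j) ∘ₗ
      LinearMap.mulRight K (gen K n j ^ M) ∘ₗ LinearMap.mulLeft K (gen K n i ^ N) = coef s := by
    refine ext_words K n fun m => ?_
    simp only [LinearMap.comp_apply, LinearMap.mulLeft_apply, LinearMap.mulRight_apply,
      gen_pow_eq_word, ← word_append, coef_word, List.append_cancel_left_eq,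
      List.append_cancel_right_eq]
  exact LinearMap.congr_fun this a

theorem coef_sandwich_eq_zero (i j : Fin n) (N M : ℕ) (l : List (Fin n)) (a : Ass K n)
    (hl : ∀ s, l ≠ List.replicate N i ++ s ++ List.replicate M j) :
    coef l (gen K n i ^ N * a * gen K n j ^ M) = 0 := by
  have : coef l ∘ₗ
      LinearMap.mulRight K (gen K n j ^ M) ∘ₗ LinearMap.mulLeft K (gen K n i ^ N) = 0 := by
    refine ext_words K n fun m => ?_
    simp only [LinearMap.comp_apply, LinearMap.mulLeft_apply, LinearMap.mulRight_apply,
      gen_pow_eq_word, ← word_append, coef_word, LinearMap.zero_apply]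
    rw [if_neg (fun h => hl m h.symm)]
  exact LinearMap.congr_fun this a

variable {α : Type*}

theorem getElem?_sandwich_left (a b : α) (N M : ℕ) (s : List α) (p : ℕ) (hp : p < N) :
    (List.replicate N a ++ s ++ List.replicate M b)[p]? = some a := by
  rw [List.append_assoc, List.getElem?_append_left (by simpa using hp)]
  simp [hp]

theorem getElem?_sandwich_mid (a b : α) (N M : ℕ) (s : List α) (p : ℕ) (hp : p < s.length) :
    (List.replicate N a ++ s ++ List.replicate M b)[N + p]? = s[p]? := by
  rw [List.append_assoc, List.getElem?_append_right (by simp), List.length_replicate,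
    Nat.add_sub_cancel_left, List.getElem?_append_left hp]

theorem getElem?_sandwich_right (a b : α) (N M : ℕ) (s : List α) (p : ℕ)
    (hp : N + s.length ≤ p) (hp' : p < N + s.length + M) :
    (List.replicate N a ++ s ++ List.replicate M b)[p]? = some b := by
  rw [List.getElem?_append_right (by simpa using hp), List.getElem?_replicate, if_pos]
  rw [List.length_append, List.length_replicate]
  omega

/-- A rotation of a word with two long blocks has long blocks in the same places only if it is
trivial. -/
theorem rotate_sandwich_ne {a b : α} (hab : a ≠ b) (N : ℕ) (w s : List α) (hN : w.length < N)
    (k : ℕ) (hk : 0 < k) (hk' : k < N + w.length + N) :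
    (List.replicate N a ++ w ++ List.replicate N b).rotate k ≠
      List.replicate N a ++ s ++ List.replicate N b := by
  intro h
  have hs : s.length = w.length := by
    have := congrArg List.length h
    simp at this
    omega
  have hV : ∀ p < N + w.length + N, (List.replicate N a ++ s ++ List.replicate N b)[p]? =
      (List.replicate N a ++ w ++ List.replicate N b)[(p + k) % (N + w.length + N)]? := by
    intro p hp
    have hl : (List.replicate N a ++ w ++ List.replicate N b).length = N + w.length + N := by
      simp only [List.length_append, List.length_replicate]
    rw [← h, List.getElem?_rotate (by rw [hl]; exact hp), hl]
  -- For each range of `k` some position carries conflicting letters: the last one if `k ≤ N`, the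
  -- one where the `b` block now starts if `N < k ≤ N + |w|` (inside the prescribed `a` block since
  -- `|w| < N`), and the first one otherwise.
  rcases le_or_gt k N with h1 | h1
  · have h2 := hV (N + w.length + N - 1) (by omega)
    rw [getElem?_sandwich_right _ _ _ _ _ _ (by omega) (by omega),
      show N + w.length + N - 1 + k = (k - 1) + (N + w.length + N) by omega, Nat.add_mod_right,
      Nat.mod_eq_of_lt (by omega), getElem?_sandwich_left _ _ _ _ _ _ (by omega)] at h2
    exact hab (Option.some.inj h2).symm
  rcases le_or_gt k (N + w.length) with h1' | h1'
  · have h2 := hV (N + w.length - k) (by omega)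
    rw [getElem?_sandwich_left _ _ _ _ _ _ (by omega), Nat.sub_add_cancel h1',
      Nat.mod_eq_of_lt (by omega),
      getElem?_sandwich_right _ _ _ _ _ _ (by omega) (by omega)] at h2
    exact hab (Option.some.inj h2)
  · have h2 := hV 0 (by omega)
    rw [getElem?_sandwich_left _ _ _ _ _ _ (by omega), Nat.zero_add,
      Nat.mod_eq_of_lt (by omega),
      getElem?_sandwich_right _ _ _ _ _ _ (by omega) (by omega)] at h2
    exact hab (Option.some.inj h2)

/-- If a rotation of a word with two long blocks has the blocks exchanged, the middle part is
absorbed by the blocks. -/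
theorem eq_of_rotate_sandwich {a b : α} (hab : a ≠ b) (N : ℕ) (w s : List α) (hN : w.length < N)
    (k : ℕ) (hk' : k < N + w.length + N)
    (h : (List.replicate N a ++ w ++ List.replicate N b).rotate k =
      List.replicate N b ++ s ++ List.replicate N a) :
    ∃ p q, w = List.replicate p a ++ List.replicate q b := by
  have hs : s.length = w.length := by
    have := congrArg List.length h
    simp at this
    omega
  have hV : ∀ p < N + w.length + N, (List.replicate N b ++ s ++ List.replicate N a)[p]? =
      (List.replicate N a ++ w ++ List.replicate N b)[(p + k) % (N + w.length + N)]? := by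
    intro p hp
    have hl : (List.replicate N a ++ w ++ List.replicate N b).length = N + w.length + N := by
      simp only [List.length_append, List.length_replicate]
    rw [← h, List.getElem?_rotate (by rw [hl]; exact hp), hl]
  rcases lt_or_ge k N with h1 | h1
  · have h2 := hV 0 (by omega)
    rw [getElem?_sandwich_left _ _ _ _ _ _ (by omega), Nat.zero_add,
      Nat.mod_eq_of_lt (by omega), getElem?_sandwich_left _ _ _ _ _ _ (by omega)] at h2
    exact absurd (Option.some.inj h2).symm hab
  rcases lt_or_ge (N + w.length) k with h1' | h1'
  · have h2 := hV (N + w.length + N - 1) (by omega)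
    rw [getElem?_sandwich_right _ _ _ _ _ _ (by omega) (by omega),
      show N + w.length + N - 1 + k = (k - 1) + (N + w.length + N) by omega, Nat.add_mod_right,
      Nat.mod_eq_of_lt (by omega),
      getElem?_sandwich_right _ _ _ _ _ _ (by omega) (by omega)] at h2
    exact absurd (Option.some.inj h2) hab
  -- In the unrotated word the prescribed `a` block occupies positions `k - N` to `k - 1` and the
  -- `b` block positions `k` to `k + N - 1`. As `|w| < N`, together they cover `w`, with the change
  -- of letter at position `k`.
  · refine ⟨k - N, N + w.length - k, List.ext_getElem? fun t => ?_⟩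
    rcases lt_or_ge t w.length with ht | ht
    · rw [← getElem?_sandwich_mid a b N N w t ht]
      rcases lt_or_ge t (k - N) with ht' | ht'
      · have h2 := hV (N + w.length + N + N + t - k) (by omega)
        rw [getElem?_sandwich_right _ _ _ _ _ _ (by omega) (by omega),
          show N + w.length + N + N + t - k + k = (N + t) + (N + w.length + N) by omega,
          Nat.add_mod_right, Nat.mod_eq_of_lt (by omega)] at h2
        rw [← h2, List.getElem?_append_left (by simpa using ht')]
        simp [ht']
      · have h2 := hV (N + t - k) (by omega)
        rw [getElem?_sandwich_left _ _ _ _ _ _ (by omega), Nat.sub_add_cancel (by omega),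
          Nat.mod_eq_of_lt (by omega)] at h2
        rw [← h2, List.getElem?_append_right (by simpa using ht'), List.getElem?_replicate, if_pos]
        rw [List.length_replicate]
        omega
    · rw [List.getElem?_eq_none ht, List.getElem?_eq_none]
      simp
      omega

theorem replicate_append_replicate_eq {a b : α} (hab : a ≠ b) {p q p' q' : ℕ}
    (h : List.replicate p a ++ List.replicate q b = List.replicate p' b ++ List.replicate q' a) :
    p = 0 ∨ q = 0 := by
  rcases Nat.eq_zero_or_pos p with hp | hp
  · exact Or.inl hp
  right
  have hp' : p' = 0 := by
    by_contra hne
    have := congrArg (fun l => l[0]?) h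
    simp [hp, Nat.pos_of_ne_zero hne] at this
    exact hab this
  subst hp'
  by_contra hne
  have : b ∈ List.replicate p a ++ List.replicate q b := by simp [hne]
  rw [h] at this
  simp at this
  exact hab this.2.symm

end

/-! ### The residues of a special derivation commuting with `δ^f_gr` -/

section

variable {u : TDer K n}

/-- Take the cyclic coefficient of `tr_sandwich` at `x_i^N w x_j^N` with `N > |w|`. On the right
only the trivial rotation contributes; on the left a contribution would force `w = x_i^p x_j^q`. -/
theorem coef_residue_sub (hu : u ∈ sder K n) (h : ∀ a, tr K n (muDefect u a) = 0) {i j : Fin n}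
    (hij : i ≠ j) (w : List (Fin n))
    (hw : ∀ p q, w ≠ List.replicate p i ++ List.replicate q j) :
    coef w (muResidue u j - muResidue u i) = 0 := by
  have h1 := congrArg (cycCoef (List.replicate (w.length + 1) i ++ w ++
    List.replicate (w.length + 1) j)) (tr_sandwich hu h i j (w.length + 1))
  have hlen : (List.replicate (w.length + 1) i ++ w ++
    List.replicate (w.length + 1) j).length = w.length + 1 + w.length + (w.length + 1) := by
    simp only [List.length_append, List.length_replicate]
  rw [cycCoef_tr, cycCoef_tr, hlen, Finset.sum_eq_zero, Finset.sum_eq_single 0,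
    List.rotate_zero, coef_sandwich] at h1
  · exact h1.symm
  · intro k hk hk0
    exact coef_sandwich_eq_zero _ _ _ _ _ _ fun s =>
      rotate_sandwich_ne hij _ w s (Nat.lt_succ_self _) k (Nat.pos_of_ne_zero hk0)
        (Finset.mem_range.1 hk)
  · intro h0
    exact absurd (Finset.mem_range.2 (by omega)) h0
  · intro k hk
    refine coef_sandwich_eq_zero _ _ _ _ _ _ fun s hs => ?_
    obtain ⟨p, q, hpq⟩ := eq_of_rotate_sandwich hij _ w s (Nat.lt_succ_self _) k
      (Finset.mem_range.1 hk) hs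
    exact hw p q hpq

/-- Exchanging `i` and `j` in `coef_residue_sub` leaves only words of both shapes `x_i^p x_j^q` and
`x_j^p x_i^q`, which are pure powers. -/
theorem coef_residue_eq (hu : u ∈ sder K n) (h : ∀ a, tr K n (muDefect u a) = 0) (i j : Fin n)
    (w : List (Fin n)) (hi : w ≠ List.replicate w.length i) (hj : w ≠ List.replicate w.length j) :
    coef w (muResidue u i) = coef w (muResidue u j) := by
  by_cases hij : i = j
  · rw [hij]
  by_cases h1 : ∀ p q, w ≠ List.replicate p i ++ List.replicate q j
  · have := coef_residue_sub hu h hij w h1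
    rw [map_sub, sub_eq_zero] at this
    exact this.symm
  by_cases h2 : ∀ p q, w ≠ List.replicate p j ++ List.replicate q i
  · have := coef_residue_sub hu h (Ne.symm hij) w h2
    rwa [map_sub, sub_eq_zero] at this
  push Not at h1 h2
  obtain ⟨p, q, rfl⟩ := h1
  obtain ⟨p', q', h2⟩ := h2
  rcases replicate_append_replicate_eq hij h2 with rfl | rfl
  · simp at hj
  · simp at hi

/-- Both sides are the coefficient of `div(u)` at the cyclic word `x_k x_i w`. -/
theorem coef_residue_rotate (hu : u ∈ sder K n) (i k : Fin n) (w : List (Fin n)) :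
    coef (i :: w) (muResidue u k) = coef (w ++ [k]) (muResidue u i) := by
  rw [← cycCoef_divergence hu, ← cycCoef_divergence hu]
  obtain ⟨a, ha⟩ := (commutators K n).mkQ_surjective (divergence u)
  have ha : tr K n a = divergence u := ha
  rw [← ha, cycCoef_tr, cycCoef_tr, ← sum_rotate_succ (k :: i :: w) fun l => coef l a]
  have hlen : (k :: i :: w).length = (i :: (w ++ [k])).length := by simp
  rw [hlen]
  refine Finset.sum_congr rfl fun m _ => ?_
  rw [List.rotate_cons_succ, List.cons_append]

theorem exists_coef_residue_eq (hu : u ∈ sder K n) (h : ∀ a, tr K n (muDefect u a) = 0) :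
    ∃ β : ℕ → K, ∀ i, ∀ w : List (Fin n), w ≠ List.replicate w.length i →
      coef w (muResidue u i) = β w.length := by
  rcases subsingleton_or_nontrivial (Fin n) with hn | hn
  -- With at most one letter, every word is a power of `x_i` and nothing is required.
  · refine ⟨0, fun i w hw => absurd ?_ hw⟩
    exact List.eq_replicate_iff.2 ⟨rfl, fun b _ => Subsingleton.elim _ _⟩
  choose σ hσ using fun a : Fin n => exists_ne a
  -- The common value at a word is read from the residue of a letter `σ a` different from its first
  -- letter `a`, since the word is then not a power of that letter.
  obtain ⟨b, hb⟩ : ∃ b : List (Fin n) → K, ∀ i, ∀ w : List (Fin n),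
      w ≠ List.replicate w.length i → coef w (muResidue u i) = b w := by
    refine ⟨fun w => match w with
      | [] => 0
      | a :: w' => coef (a :: w') (muResidue u (σ a)), fun i w hw => ?_⟩
    cases w with
    | nil => simp at hw
    | cons a w =>
      refine coef_residue_eq hu h i (σ a) _ hw fun h1 => ?_
      rw [List.length_cons, List.replicate_succ, List.cons.injEq] at h1
      exact hσ a h1.1.symm
  -- The first letter may be dropped and an arbitrary letter appended. Repeating this replaces all
  -- letters, so `b` depends on the length only. If `x_i w` is a power of `x_j`, or `w x_j` a power
  -- of `x_i`, then the two words coincide.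
  have hrot : ∀ (i j : Fin n) (w : List (Fin n)), b (i :: w) = b (w ++ [j]) := by
    intro i j w
    by_cases h1 : w ++ [j] = List.replicate (w ++ [j]).length i
    · have hji : j = i := by
        have : j ∈ w ++ [j] := by simp
        rw [h1] at this
        exact List.eq_of_mem_replicate this
      subst hji
      have hw : w = List.replicate w.length j := by
        rw [List.length_append, List.length_singleton, List.replicate_succ'] at h1
        exact List.append_cancel_right h1
      rw [hw, ← List.replicate_succ, ← List.replicate_succ']
    · have h2 : i :: w ≠ List.replicate (i :: w).length j := by
        intro h2
        rw [List.length_cons, List.replicate_succ, List.cons.injEq] at h2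
        refine h1 ?_
        rw [h2.1, List.length_append, List.length_singleton, List.replicate_succ', ← h2.2]
      rw [← hb i _ h1, ← hb j _ h2, coef_residue_rotate hu]
  have hconst : ∀ w s v : List (Fin n), w.length = v.length → b (w ++ s) = b (s ++ v) := by
    intro w
    induction w with
    | nil =>
      intro s v hv
      rw [List.eq_nil_of_length_eq_zero hv.symm, List.nil_append, List.append_nil]
    | cons i w ih =>
      intro s v hv
      cases v with
      | nil => simp at hv
      | cons j v =>
        rw [List.cons_append, hrot i j, List.append_assoc, ih (s ++ [j]) v (by simpa using hv),
          List.append_assoc, List.singleton_append]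
  obtain ⟨a₀⟩ : Nonempty (Fin n) := inferInstance
  refine ⟨fun m => b (List.replicate m a₀), fun i w hw => ?_⟩
  rw [hb i w hw]
  simpa using hconst w [] (List.replicate w.length a₀) (by simp)

variable [CharZero K]

theorem mem_krv_iff_commutes (u : TDer K n) :
    u ∈ krv K n ↔ u ∈ sder K n ∧
      tensorAct (rhoTr u) ∘ₗ deltaGr K n = deltaGr K n ∘ₗ rhoTr u := by
  rw [mem_krv_iff]
  refine and_congr_right fun hu => ⟨?_, fun h => ?_⟩
  · rintro ⟨β, hβ⟩
    obtain ⟨b, hb⟩ := exists_muDefect_eq_inner hu β hβ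
    refine LinearMap.ext fun t => ?_
    obtain ⟨a, rfl⟩ := (commutators K n).mkQ_surjective t
    have h1 := deltaGr_defect u a
    rw [hb, lTensor_tr_closeDelta_inner, map_zero, sub_eq_zero] at h1
    exact h1
  · exact exists_coef_residue_eq hu (tr_muDefect_eq_zero hu h)

theorem mem_krv₀_iff_commutes (u : TDer K n) :
    u ∈ krv₀ K n ↔ u ∈ sder K n ∧ rho u ∘ₗ muGr K n = muGr K n ∘ₗ rho u := by
  rw [mem_krv₀_iff]
  refine and_congr_right fun hu => ?_
  rw [← muDefect_eq_zero_iff hu, muDefect, sub_eq_zero]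

end

end KV

end

theorem theorem5p4 {K : Type*} [Field K] [CharZero K] (n : ℕ) (u : KV.TDer K n) :
    (u ∈ KV.krv K n ↔
      (KV.rho u ∘ₗ KV.etaGr K n = KV.etaGr K n ∘ₗ KV.tensorAct (KV.rho u) ∧
        KV.tensorAct (KV.rhoTr u) ∘ₗ KV.deltaGr K n = KV.deltaGr K n ∘ₗ KV.rhoTr u)) ∧
    (u ∈ KV.krv₀ K n ↔
      (KV.rho u ∘ₗ KV.etaGr K n = KV.etaGr K n ∘ₗ KV.tensorAct (KV.rho u) ∧
        KV.rho u ∘ₗ KV.muGr K n = KV.muGr K n ∘ₗ KV.rho u)) := by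
  rw [KV.mem_krv_iff_commutes, KV.mem_krv₀_iff_commutes, KV.mem_sder_iff_commutesEta,
    KV.commutesEta_iff]
  exact ⟨Iff.rfl, Iff.rfl⟩
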